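/- **Theorem 2.8.** Let $1\to K\xrightarrow{i} G\xrightarrow{p} Q\to 1$ be a short exact sequence of finitely generated groups, where $K$ is non-elementary (not virtually cyclic). Let $K_1$ be a proper subgroup of $K$ such that $K$ is strongly hyperbolic relative to $K_1$, and suppose that $G$ preserves cusps: for every $g\in G$ there is $k\in K$ with $gK_1g^{-1}=kK_1k^{-1}$ (where $K$ is identified with $i(K)$). Then there are a map $s\colon Q\to G$ with $p\circ s=\mathrm{id}_Q$ and constants $R\ge 1$, $\epsilon\ge 0$ such that $$\frac1R\,d_Q(q,q')-\epsilon\;\le\; d_G(s(q),s(q'))\;\le\; R\,d_Q(q,q')+\epsilon\qquad\text{for all } q,q'\in Q,$$ where $d_G$ and $d_Q$ are word metrics for finite generating sets of $G$ and $Q$; the map $s$ can be chosen independently of these generating sets, while $R$ and $\epsilon$ may depend on them. Here $K$ is *strongly hyperbolic relative to* $K_1$ (in the sense of Farb) if $K_1$ is finitely generated and, for some finite generating set of $K$ with Cayley graph $\Gamma_K$, the following two conditions hold. 1. The coned-off Cayley graph $\widehat\Gamma_K$ is Gromov hyperbolic. It is obtained from $\Gamma_K$ (with edges of length $1$) by adding,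 for each left coset $gK_1$, a vertex $v(gK_1)$ joined to each element of $gK_1$ by an edge of length $1/2$. 2. (Bounded coset penetration.) For every $P\ge 1$ there is a constant $D$ such that the following holds for every left coset $c$ of $K_1$ and any two edge paths $\alpha,\beta$ in $\widehat\Gamma_K$ which start at the same element of $K$, end at the same element of $K$, are $P$-quasigeodesics (each subpath with ends $x,y$ has length at most $P\,d(x,y)+P$, with $d$ the distance in $\widehat\Gamma_K$), and never return to a left coset of $K_1$ after leaving it (the vertex $v(gK_1)$ is counted as part of $gK_1$). Say that a path penetrates $c$ if it passes through $v(c)$. If $\alpha$ penetrates $c$ and $\beta$ does not, then the first and the last elements of $c$ on $\alpha$ are at distance at most $D$ in $\Gamma_K$. If both penetrate $c$, then the first elements of $c$ on $\alpha$ and on $\beta$ are at distance at most $D$ in $\Gamma_K$, and so are the last ones. -/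

import Mathlib

open scoped Pointwise

namespace RelHyp

universe u v w

section WordMetric

variable {G : Type u} [Group G]

/-- The word metric of `G` with respect to `S`: the edge-path distance in the Cayley graph, in
which `g` and `g * s` are adjacent for every `s ∈ S`. It is only used when `S` generates `G`, and
then the Cayley graph is connected. -/
noncomputable def wordDist (S : Set G) (g h : G) : ℕ :=
  (SimpleGraph.mulCayley S).dist g h

end WordMetric

section ConedOff

variable {K : Type u} [Group K]

/-- Vertices of the coned-off Cayley graph: the elements of `K`, and one cone vertex `v(gH)` for
every left coset `gH`. -/
abbrev ConeVertex (H : Subgroup K) : Type u := K ⊕ (K ⧸ H)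

/-- The coned-off Cayley graph: the Cayley graph together with an edge from every element `g` of
`K` to the cone vertex of its left coset `gH`. -/
def conedOffGraph (S : Set K) (H : Subgroup K) : SimpleGraph (ConeVertex H) where
  Adj
    | Sum.inl a, Sum.inl b => (SimpleGraph.mulCayley S).Adj a b
    | Sum.inl a, Sum.inr c => (a : K ⧸ H) = c
    | Sum.inr c, Sum.inl a => (a : K ⧸ H) = c
    | Sum.inr _, Sum.inr _ => False
  symm := ⟨by
    rintro (a | c) (b | d) h
    · exact h.symm
    · exact h
    · exact h
    · exact h⟩
  loopless := ⟨by
    rintro (a | c) h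
    · exact (SimpleGraph.mulCayley S).loopless.irrefl a h
    · exact h⟩

/-- Length of the edge between two adjacent vertices of the coned-off graph: `1` for an edge of
the Cayley graph and `1/2` for an edge at a cone vertex. -/
noncomputable def edgeLength {H : Subgroup K} : ConeVertex H → ConeVertex H → ℝ
  | Sum.inl _, Sum.inl _ => 1
  | _, _ => 1 / 2

/-- Length of an edge path in the coned-off graph. -/
noncomputable def electricLength {S : Set K} {H : Subgroup K} {x y : ConeVertex H}
    (γ : (conedOffGraph S H).Walk x y) : ℝ :=
  (γ.darts.map fun e => edgeLength e.fst e.snd).sum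

/-- The electric distance: infimum of the lengths of the edge paths between two vertices. -/
noncomputable def electricDist (S : Set K) (H : Subgroup K) (x y : ConeVertex H) : ℝ :=
  ⨅ γ : (conedOffGraph S H).Walk x y, electricLength γ

/-- Gromov's four-point condition for a distance function `d`. -/
def IsGromovHyperbolic {V : Type u} (d : V → V → ℝ) : Prop :=
  ∃ δ : ℝ, ∀ x y z t : V, d x y + d z t ≤ max (d x z + d y t) (d x t + d y z) + 2 * δ

/-- `K` is weakly hyperbolic relative to `H`: the coned-off Cayley graph is hyperbolic (the
condition is tested on the vertices, which are `1/2`-dense in the metric graph). -/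
def IsWeaklyHyperbolic (S : Set K) (H : Subgroup K) : Prop :=
  IsGromovHyperbolic (electricDist S H)

variable {S : Set K} {H : Subgroup K} {x y : ConeVertex H}

/-- `γ` is an electric `P`-quasigeodesic: every subpath is at most `P d + P` long, where `d` is the
electric distance between the ends of the subpath. -/
def IsElectricQuasigeodesic (P : ℝ) (γ : (conedOffGraph S H).Walk x y) : Prop :=
  ∀ (a b : ConeVertex H) (γ₁ : (conedOffGraph S H).Walk x a) (γ₂ : (conedOffGraph S H).Walk a b)
    (γ₃ : (conedOffGraph S H).Walk b y), γ = γ₁.append (γ₂.append γ₃) →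
      electricLength γ₂ ≤ P * electricDist S H a b + P

/-- The left coset to which a vertex belongs; a cone vertex `v(gH)` is counted with `gH`. -/
def cosetOf : ConeVertex H → K ⧸ H
  | Sum.inl a => (a : K ⧸ H)
  | Sum.inr c => c

/-- `γ` does not return to any left coset after leaving it. -/
def WithoutBacktracking (γ : (conedOffGraph S H).Walk x y) : Prop :=
  ∀ i j k : ℕ, i ≤ j → j ≤ k → k ≤ γ.length →
    cosetOf (γ.getVert i) = cosetOf (γ.getVert k) →
      cosetOf (γ.getVert j) = cosetOf (γ.getVert i)

/-- `γ` penetrates the coset `c`: it passes through the cone vertex of `c`. -/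
def Penetrates (γ : (conedOffGraph S H).Walk x y) (c : K ⧸ H) : Prop :=
  Sum.inr c ∈ γ.support

/-- `g` is the vertex at which `γ` first enters the coset `c`. -/
def IsEntryPoint (γ : (conedOffGraph S H).Walk x y) (c : K ⧸ H) (g : K) : Prop :=
  ∃ i ≤ γ.length, γ.getVert i = Sum.inl g ∧ (g : K ⧸ H) = c ∧
    ∀ j < i, cosetOf (γ.getVert j) ≠ c

/-- `g` is the vertex at which `γ` last exits from the coset `c`. -/
def IsExitPoint (γ : (conedOffGraph S H).Walk x y) (c : K ⧸ H) (g : K) : Prop :=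
  IsEntryPoint γ.reverse c g

/-- The bounded coset penetration property. Paths start and end at elements of `K`. -/
def BoundedCosetPenetration (S : Set K) (H : Subgroup K) : Prop :=
  ∀ P : ℝ, 1 ≤ P → ∃ D : ℝ, ∀ (a b : K)
    (α β : (conedOffGraph S H).Walk (Sum.inl a) (Sum.inl b)),
    IsElectricQuasigeodesic P α → WithoutBacktracking α →
    IsElectricQuasigeodesic P β → WithoutBacktracking β →
    ∀ c : K ⧸ H, Penetrates α c →
      (¬ Penetrates β c →
        ∀ g h : K, IsEntryPoint α c g → IsExitPoint α c h → (wordDist S g h : ℝ) ≤ D) ∧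
      (Penetrates β c →
        (∀ g h : K, IsEntryPoint α c g → IsEntryPoint β c h → (wordDist S g h : ℝ) ≤ D) ∧
        (∀ g h : K, IsExitPoint α c g → IsExitPoint β c h → (wordDist S g h : ℝ) ≤ D))

/-- `K` is strongly hyperbolic relative to the finitely generated subgroup `H` (in the sense of
Farb): for some finite generating set of `K`, the coned-off Cayley graph is hyperbolic and bounded
coset penetration holds. -/
def IsStronglyHyperbolic (K : Type u) [Group K] (H : Subgroup K) : Prop :=
  H.FG ∧ ∃ S : Finset K, Subgroup.closure (S : Set K) = ⊤ ∧
    IsWeaklyHyperbolic (S : Set K) H ∧ BoundedCosetPenetration (S : Set K) H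

end ConedOff

/-- A group is elementary if it is virtually cyclic, that is, finite or virtually infinite
cyclic. -/
def IsElementary (K : Type u) [Group K] : Prop :=
  ∃ C : Subgroup K, IsCyclic C ∧ C.FiniteIndex

/-- `G` preserves cusps, for an embedding `i : K → G`: every conjugate of (the image of) `K₁` by an
element of `G` is a conjugate by an element of `K`. -/
def PreservesCusps {K : Type u} {G : Type v} [Group K] [Group G] (i : K →* G)
    (K₁ : Subgroup K) : Prop :=
  ∀ g : G, ∃ k : K, MulAut.conj g • K₁.map i = MulAut.conj (i k) • K₁.map i

/-- `s` is an `(R, ε)` quasi-isometric section of `p`, for the word metrics of the generating sets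
`S` of `G` and `T` of `Q`. -/
def IsQuasiIsometricSection {G : Type v} {Q : Type w} [Group G] [Group Q] (p : G →* Q)
    (S : Set G) (T : Set Q) (R ε : ℝ) (s : Q → G) : Prop :=
  (∀ q, p (s q) = q) ∧
  ∀ q q' : Q, 1 / R * (wordDist T q q' : ℝ) - ε ≤ (wordDist S (s q) (s q') : ℝ) ∧
    (wordDist S (s q) (s q') : ℝ) ≤ R * (wordDist T q q' : ℝ) + ε

end RelHyp

/-! It suffices to find a set `A ⊆ G` which meets every coset of `K` and such that, for each `t`,
only finitely many `k ∈ K` satisfy `a * t * k ∈ A` for some `a ∈ A`. If `s q ∈ A` lies over `q`,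
then for each generator `t` of `Q` the element `(s q)⁻¹ * s (q * t)` takes finitely many values, so
`s` is Lipschitz; the lower bound holds because `p` is Lipschitz (`exists_section_of_transversal`).

Suppose `K₁` is infinite. Bounded coset penetration makes it self-normalizing (`mem_of_normalizes`),
so its conjugates in `K` correspond to the cosets `x K₁`, and by preservation of cusps `G` acts on
these cosets. Fix `b ∉ K₁`, and let `A` consist of those `g` for which some shortest electric path
from the coset `g⁻¹ · K₁` to the coset `g⁻¹ · b K₁` starts at `1`. Each `t ∈ G` acts through a
coset-preserving bilipschitz bijection of `K`. By stability of quasigeodesics and bounded coset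
penetration, this bijection carries starting points of shortest paths close to starting points
(`exists_wordDist_closest_le`), which gives the finiteness.

If `K₁` is finite, adding it to the generators shows that `K` itself is a non-elementary hyperbolic
group. The pair of cosets is replaced by triples tending to infinity with center `1`
(`exists_large_triples`), and `A` consists of those `g` for which `1` is a center of the triples
moved by `g⁻¹`, along an ultrafilter. Automorphisms coarsely preserve centers, centers are coarsely
unique, and conjugation by `k ∈ K` stays at bounded distance from left translation by `k`, which
does not affect centers of distant triples. -/

/-! ### Discrete hyperbolic metrics: stability of quasigeodesics, and centers of triples. -/

/-- A discrete geodesic metric which satisfies Gromov's four-point condition. -/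
structure IsHypMetric {V : Type*} (d : V → V → ℕ) (δ : ℕ) : Prop where
  eq_zero : ∀ x y, d x y = 0 ↔ x = y
  comm : ∀ x y, d x y = d y x
  triangle : ∀ x y z, d x z ≤ d x y + d y z
  four : ∀ x y z t, d x y + d z t ≤ max (d x z + d y t) (d x t + d y z) + 2 * δ
  exists_between : ∀ x y n, n ≤ d x y → ∃ z, d x z = n ∧ d x z + d z y = d x y

/-- Exponential growth beats linear growth. In the stability argument a detour of length about `D`
is bisected `m` times, at a cost linear in `m`, and this cost must stay below `2 * D`. -/
theorem exists_forall_mul_le_two_pow (a b c : ℕ) :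
    ∃ R : ℕ, ∀ D, R ≤ D → ∃ m : ℕ, a * D ≤ 2 ^ m ∧ b * m + c < 2 * D := by
  have h1 : ∃ M : ℕ, ∀ m, M ≤ m → a * (b + 1) * (m + 1) ≤ 2 ^ m := by
    generalize a * (b + 1) = e
    have h := (tendsto_pow_const_div_const_pow_of_one_lt 1 (r := (2 : ℝ)) (by norm_num))
    have h2 : ∀ᶠ n : ℕ in Filter.atTop, (n : ℝ) ^ 1 / 2 ^ n < 1 / (2 * e + 1) :=
      h.eventually (gt_mem_nhds (by positivity))
    obtain ⟨M, hM⟩ := Filter.eventually_atTop.1 h2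
    refine ⟨M + 1, fun m hm => ?_⟩
    have h3 := hM m (by omega)
    rw [div_lt_div_iff₀ (by positivity) (by positivity)] at h3
    have h4 : ((m * (2 * e + 1) : ℕ) : ℝ) < ((2 ^ m : ℕ) : ℝ) := by
      push_cast
      linarith
    have h5 : m * (2 * e + 1) < 2 ^ m := by exact_mod_cast h4
    have : e * 1 ≤ e * m := Nat.mul_le_mul_left _ (by omega)
    nlinarith
  obtain ⟨M, hM⟩ := h1
  refine ⟨(b + 1) * M + c + 1, fun D hD => ⟨D / (b + 1), ?_, ?_⟩⟩
  · have h2 : M ≤ D / (b + 1) := by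
      rw [Nat.le_div_iff_mul_le (by omega)]
      nlinarith
    refine le_trans ?_ (hM _ h2)
    have h3 : D ≤ (b + 1) * (D / (b + 1) + 1) := by
      have := Nat.lt_mul_div_succ D (show 0 < b + 1 by omega)
      exact this.le
    calc a * D ≤ a * ((b + 1) * (D / (b + 1) + 1)) := Nat.mul_le_mul_left _ h3
      _ = _ := by ring
  · have h2 : (b + 1) * (D / (b + 1)) ≤ D := Nat.mul_div_le D (b + 1)
    have h3 : (b + 1) * M ≥ 0 := Nat.zero_le _
    have h4 : b * (D / (b + 1)) ≤ (b + 1) * (D / (b + 1)) := Nat.mul_le_mul_right _ (by omega)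
    omega

/-- `m` is a `κ`-center of the triple `x`, `y`, `z`: the doubled Gromov products of the triple at
`m` are at most `κ`. -/
structure IsCenter {V : Type*} (d : V → V → ℕ) (κ : ℕ) (m x y z : V) : Prop where
  xy : d m x + d m y ≤ d x y + κ
  yz : d m y + d m z ≤ d y z + κ
  xz : d m x + d m z ≤ d x z + κ

namespace IsHypMetric

variable {V : Type*} {d : V → V → ℕ} {δ : ℕ}

theorem self (H : IsHypMetric d δ) (x : V) : d x x = 0 := (H.eq_zero x x).2 rfl

/-- The four-point condition read at `p`: doubled Gromov products satisfy the ultrametric inequality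
up to `2 * δ`. -/
theorem product_trans (H : IsHypMetric d δ) {p x y z : V} {A : ℕ}
    (h1 : A + d x y ≤ d p x + d p y) (h2 : A + d y z ≤ d p y + d p z) :
    A + d x z ≤ d p x + d p z + 2 * δ := by
  have h := H.four x z y p
  have e1 := H.comm x p
  have e2 := H.comm y p
  have e3 := H.comm z p
  have e4 := H.comm z y
  omega

/-- Repeated bisection: each level costs `2 * δ`, so the loss is only logarithmic in the length of
the chain. The bound on `d p (f j)` serves the degenerate chain `i = k`. -/
theorem product_chain (H : IsHypMetric d δ) (p : V) (f : ℕ → V) (A : ℕ) (m : ℕ) :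
    ∀ i k, i ≤ k → k - i ≤ 2 ^ m → (∀ j, i ≤ j → j ≤ k → A ≤ 2 * d p (f j)) →
      (∀ j, i ≤ j → j < k → A + d (f j) (f (j + 1)) ≤ d p (f j) + d p (f (j + 1))) →
      A + d (f i) (f k) ≤ d p (f i) + d p (f k) + 2 * δ * m := by
  induction m with
  | zero =>
    intro i k hik hk h1 h2
    rcases Nat.eq_or_lt_of_le hik with rfl | hlt
    · have := h1 i le_rfl le_rfl
      rw [H.self]
      omega
    · have hk' : k = i + 1 := by omega
      subst hk'
      have := h2 i le_rfl (by omega)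
      omega
  | succ m ih =>
    intro i k hik hk h1 h2
    rw [pow_succ] at hk
    obtain ⟨l, hil, hlk, hl1, hl2⟩ : ∃ l, i ≤ l ∧ l ≤ k ∧ l - i ≤ 2 ^ m ∧ k - l ≤ 2 ^ m :=
      ⟨i + (k - i) / 2, by omega, by omega, by omega, by omega⟩
    have e1 := ih i l hil hl1 (fun j a b => h1 j a (by omega)) (fun j a b => h2 j a (by omega))
    have e2 := ih l k hlk hl2 (fun j a b => h1 j (by omega) b) (fun j a b => h2 j (by omega) b)
    have e3 := H.product_trans (A := A - 2 * δ * m) (p := p) (x := f i) (y := f l) (z := f k)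
      (by have := H.triangle (f i) p (f l); have := H.comm (f i) p; omega)
      (by have := H.triangle (f l) p (f k); have := H.comm (f l) p; omega)
    rw [mul_add, mul_one]
    omega

theorem exists_near_interval (H : IsHypMetric d δ) {x y p : V} {κ : ℕ}
    (h : d x p + d p y ≤ d x y + κ) :
    ∃ q, d x q + d q y = d x y ∧ d p q ≤ κ + 2 * δ := by
  obtain ⟨q, hq1, hq2⟩ := H.exists_between x y (min (d x p) (d x y)) (min_le_right _ _)
  refine ⟨q, hq2, ?_⟩
  have h4 := H.four x y p q
  have e1 := H.comm y q
  have e2 := H.comm y p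
  have := H.triangle x p y
  omega

/-- Points of a geodesic are uniformly close to any quasigeodesic with the same ends. -/
theorem exists_near_of_quasigeodesic (H : IsHypMetric d δ) (L κ : ℕ) :
    ∃ R : ℕ, ∀ (c : ℕ → V) (n : ℕ), (∀ j < n, d (c j) (c (j + 1)) ≤ L) →
      (∀ i j, i ≤ j → j ≤ n → j - i ≤ L * d (c i) (c j)) →
      ∀ p, d (c 0) p + d p (c n) ≤ d (c 0) (c n) + κ → ∃ j ≤ n, d p (c j) ≤ R := by
  obtain ⟨R, hR⟩ := exists_forall_mul_le_two_pow (L * 6) (2 * δ) (L + 4 * δ)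
  refine ⟨R + κ + 2 * δ, fun c n h1 h2 p hp => ?_⟩
  obtain ⟨q, hq, hpq⟩ := H.exists_near_interval hp
  by_contra! hcon
  -- Choose `D` maximal such that some point between the ends has distance at least `D` from the
  -- whole path; by maximality every point between the ends is within `D` of the path.
  let P : ℕ → Prop := fun D => ∃ q, d (c 0) q + d q (c n) = d (c 0) (c n) ∧
    ∀ j ≤ n, D ≤ d q (c j)
  have hP : P R := ⟨q, hq, fun j hj => by
    have := hcon j hj
    have := H.triangle p q (c j)
    omega⟩
  have hPb : ∀ D, P D → D ≤ d (c 0) (c n) := by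
    rintro D ⟨q, hq, hD⟩
    have := hD 0 (by omega)
    have := H.comm q (c 0)
    omega
  classical
  obtain ⟨D, hRD, hPD, hmax⟩ : ∃ D, R ≤ D ∧ P D ∧ ¬ P (D + 1) := by
    refine ⟨Nat.findGreatest P (d (c 0) (c n)), Nat.le_findGreatest (hPb _ hP) hP,
      Nat.findGreatest_spec (hPb _ hP) hP, fun h => ?_⟩
    have := Nat.le_findGreatest (hPb _ h) h
    omega
  obtain ⟨p, hp, hpD⟩ := hPD
  obtain ⟨m, hm1, hm2⟩ := hR D hRD
  have hnear : ∀ q, d (c 0) q + d q (c n) = d (c 0) (c n) → ∃ j ≤ n, d q (c j) ≤ D := by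
    intro q hq
    by_contra! hc
    exact hmax ⟨q, hq, fun j hj => hc j hj⟩
  -- Go back from `p` by `2 * D`, or to the end if that is closer, and then jump to the path. The
  -- jump stays so far from `p` that the doubled product of `a` and `c j` at `p` is at least `2 *
  -- D`.
  obtain ⟨a, j, hj, ha1, ha2, ha3, ha4⟩ : ∃ a j, j ≤ n ∧ d (c 0) a + d a p = d (c 0) p ∧
      d a p ≤ 2 * D ∧ d a (c j) ≤ D ∧ 2 * D + d a (c j) ≤ d p a + d p (c j) := by
    by_cases h : d (c 0) p ≤ 2 * D
    · refine ⟨c 0, 0, by omega, by rw [H.self]; omega, h, by rw [H.self]; omega, ?_⟩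
      have := hpD 0 (by omega)
      rw [H.self]
      omega
    · obtain ⟨a, ha1, ha2⟩ := H.exists_between p (c 0) (2 * D) (by rw [H.comm]; omega)
      have e1 := H.comm p a
      have e2 := H.comm a (c 0)
      have e3 := H.comm p (c 0)
      have e4 := H.triangle (c 0) a (c n)
      have e5 := H.triangle a p (c n)
      obtain ⟨j, hj, haj⟩ := hnear a (by omega)
      refine ⟨a, j, hj, by omega, by omega, haj, ?_⟩
      have := hpD j hj
      omega
  obtain ⟨b, k, hk, hb1, hb2, hb3, hb4⟩ : ∃ b k, k ≤ n ∧ d p b + d b (c n) = d p (c n) ∧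
      d p b ≤ 2 * D ∧ d b (c k) ≤ D ∧ 2 * D + d b (c k) ≤ d p b + d p (c k) := by
    by_cases h : d p (c n) ≤ 2 * D
    · refine ⟨c n, n, by omega, by rw [H.self]; omega, h, by rw [H.self]; omega, ?_⟩
      have := hpD n (by omega)
      rw [H.self]
      omega
    · obtain ⟨b, hb1, hb2⟩ := H.exists_between p (c n) (2 * D) (by omega)
      have e4 := H.triangle (c 0) b (c n)
      have e5 := H.triangle (c 0) p b
      obtain ⟨k, hk, hbk⟩ := hnear b (by omega)
      refine ⟨b, k, hk, by omega, by omega, hbk, ?_⟩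
      have := hpD k hk
      omega
  have hjk : d (c j) (c k) ≤ 6 * D := by
    have e1 := H.triangle (c j) a (c k)
    have e2 := H.triangle a p (c k)
    have e3 := H.triangle p b (c k)
    have e4 := H.comm (c j) a
    omega
  have key : ∀ j k, j ≤ k → k ≤ n → d (c j) (c k) ≤ 6 * D →
      (2 * D - L) + d (c j) (c k) ≤ d p (c j) + d p (c k) + 2 * δ * m := by
    intro j k hjk hk hd
    apply H.product_chain p c _ m j k hjk
    · refine le_trans (h2 j k hjk hk) (le_trans ?_ hm1)
      rw [mul_assoc]
      exact Nat.mul_le_mul_left _ hd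
    · intro l _ hl
      have := hpD l (by omega)
      omega
    · intro l _ hl
      have := hpD l (by omega)
      have := hpD (l + 1) (by omega)
      have := h1 l (by omega)
      have := H.triangle (c l) p (c (l + 1))
      have := H.comm (c l) p
      omega
  have hmid : (2 * D - L) + d (c j) (c k) ≤ d p (c j) + d p (c k) + 2 * δ * m := by
    rcases le_total j k with h | h
    · exact key j k h hk hjk
    · have := key k j h hj (by rw [H.comm]; exact hjk)
      have := H.comm (c j) (c k)
      omega
  -- The chain `a`, `c j`, `c k`, `b` forces a positive product of `a` and `b` at `p`, although `p`
  -- lies between them.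
  have t1 := H.triangle (c j) p (c k)
  have t2 := H.comm (c j) p
  have s1 := H.product_trans (A := 2 * D - L - 2 * δ * m) (p := p) (x := a) (y := c j) (z := c k)
    (by omega) (by omega)
  have t3 := H.triangle a p (c k)
  have t4 := H.comm a p
  have s2 := H.product_trans (A := 2 * D - L - 2 * δ * m - 2 * δ) (p := p) (x := a) (y := c k)
    (z := b) (by omega) (by have := H.comm b (c k); omega)
  have t5 := H.triangle (c 0) a (c n)
  have t6 := H.triangle a b (c n)
  omega

/-- The center is the point of a geodesic from `x` to `y` whose distance to `x` is the Gromov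
product of `y` and `z` at `x`; the extra `2` absorbs rounding. -/
theorem exists_isCenter (H : IsHypMetric d δ) (x y z : V) :
    ∃ m, IsCenter d (2 * δ + 2) m x y z := by
  obtain ⟨m, hm1, hm2⟩ := H.exists_between x y ((d x y + d x z - d y z) / 2)
    (by have := H.triangle x y z; omega)
  refine ⟨m, ?_, ?_, ?_⟩ <;>
  · have e1 := H.comm m x
    have e2 := H.comm m y
    have e3 := H.comm m z
    have e4 := H.triangle x y z
    have e5 := H.triangle y x z
    have e6 := H.comm x y
    have e7 := H.four x y m z
    omega

/-- Otherwise the four-point condition would force, in each pair of vertices, one to be strictly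
closer to `m` and the other strictly closer to `m'`; this is impossible for all three pairs. -/
theorem dist_isCenter_le (H : IsHypMetric d δ) {κ : ℕ} {m m' x y z : V}
    (h : IsCenter d κ m x y z) (h' : IsCenter d κ m' x y z) : d m m' ≤ κ + 2 * δ := by
  obtain ⟨a1, a2, a3⟩ := h
  obtain ⟨b1, b2, b3⟩ := h'
  have f1 := H.four x y m m'
  have f2 := H.four y z m m'
  have f3 := H.four x z m m'
  have := H.comm x m
  have := H.comm y m
  have := H.comm z m
  have := H.comm x m'
  have := H.comm y m'
  have := H.comm z m'
  omega

theorem product_le_of_near (H : IsHypMetric d δ) {κ r : ℕ} {m x x' y : V}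
    (h : d m x + d m y ≤ d x y + κ) (hx : d x x' ≤ r) (hfar : κ + 2 * δ + 2 * r < 2 * d m x) :
    d m x' + d m y ≤ d x' y + κ + 2 * δ := by
  have f := H.four x y m x'
  have := H.comm x m
  have := H.comm y m
  have := H.comm m x'
  have := H.comm y x'
  have := H.triangle m x x'
  have := H.triangle m x' x
  have := H.comm x x'
  omega

/-- The displacement `r` enters only the requirement that the vertices be far from `m`, not the new
constant. Hence one fixed constant later serves all translations. -/
theorem isCenter_of_near (H : IsHypMetric d δ) {κ r : ℕ} {m x y z x' y' z' : V}
    (h : IsCenter d κ m x y z) (hx : d x x' ≤ r) (hy : d y y' ≤ r) (hz : d z z' ≤ r)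
    (fx : κ + 4 * δ + 2 * r < 2 * d m x) (fy : κ + 4 * δ + 2 * r < 2 * d m y)
    (fz : κ + 4 * δ + 2 * r < 2 * d m z) : IsCenter d (κ + 4 * δ) m x' y' z' := by
  have aux : ∀ {x y x' y' : V}, d m x + d m y ≤ d x y + κ → d x x' ≤ r → d y y' ≤ r →
      κ + 4 * δ + 2 * r < 2 * d m x → κ + 4 * δ + 2 * r < 2 * d m y →
      d m x' + d m y' ≤ d x' y' + (κ + 4 * δ) := by
    intro x y x' y' h hx hy fx fy
    have h1 := H.product_le_of_near h hx (by omega)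
    have h2 := H.product_le_of_near (κ := κ + 2 * δ) (m := m) (x := y) (x' := y') (y := x')
      (by rw [H.comm y x']; omega) hy (by omega)
    have := H.comm x' y'
    omega
  exact ⟨aux h.xy hx hy fx fy, aux h.yz hy hz fy fz, aux h.xz hx hz fx fz⟩

theorem exists_geodesic (H : IsHypMetric d δ) (x y : V) :
    ∃ g : ℕ → V, g 0 = x ∧ g (d x y) = y ∧
      ∀ s t, s ≤ t → t ≤ d x y → d (g s) (g t) = t - s := by
  suffices h : ∀ n x, d x y = n → ∃ g : ℕ → V, g 0 = x ∧ g n = y ∧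
      ∀ s t, s ≤ t → t ≤ n → d (g s) (g t) = t - s from h _ x rfl
  intro n
  induction n with
  | zero =>
    intro x hx
    have := (H.eq_zero x y).1 hx
    refine ⟨fun _ => x, rfl, this, fun s t _ ht => ?_⟩
    rw [H.self]
    omega
  | succ n ih =>
    intro x hx
    obtain ⟨z, hz1, hz2⟩ := H.exists_between x y 1 (by omega)
    obtain ⟨g, g0, gn, hg⟩ := ih z (by omega)
    refine ⟨fun t => if t = 0 then x else g (t - 1), by simp, by simpa using gn, ?_⟩
    intro s t hst ht
    by_cases h0 : s = 0
    · by_cases h1 : t = 0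
      · simp [h0, h1, H.self]
      · simp only [h0, h1, if_true, if_false]
        have e1 := hg 0 (t - 1) (by omega) (by omega)
        have e2 := hg (t - 1) n (by omega) le_rfl
        have e3 := H.triangle x z (g (t - 1))
        have e4 := H.triangle x (g (t - 1)) y
        rw [g0] at e1
        rw [gn] at e2
        omega
    · have h1 : t ≠ 0 := by omega
      simp only [h0, h1, if_false]
      rw [hg _ _ (by omega) (by omega)]
      omega

/-- A bilipschitz bijection coarsely preserves Gromov products. -/
theorem exists_product_map_le (H : IsHypMetric d δ) (φ : V ≃ V) (L κ : ℕ)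
    (hφ : ∀ x y, d (φ x) (φ y) ≤ L * d x y) (hφ' : ∀ x y, d (φ.symm x) (φ.symm y) ≤ L * d x y) :
    ∃ κ', ∀ m x y, d m x + d m y ≤ d x y + κ →
      d (φ m) (φ x) + d (φ m) (φ y) ≤ d (φ x) (φ y) + κ' := by
  obtain ⟨R, hR⟩ := H.exists_near_of_quasigeodesic L κ
  refine ⟨2 * (L * R), fun m x y h => ?_⟩
  obtain ⟨g, g0, gn, hg⟩ := H.exists_geodesic (φ x) (φ y)
  -- The geodesic from `φ x` to `φ y`, pulled back by `φ`, is a quasigeodesic from `x` to `y`, so it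
  -- passes near `m`.
  obtain ⟨j, hj, hmj⟩ := hR (fun j => φ.symm (g j)) (d (φ x) (φ y))
    (fun j hj => (hφ' _ _).trans (by rw [hg j (j + 1) (by omega) hj]; simp))
    (fun i j hij hj => by
      have := hφ (φ.symm (g i)) (φ.symm (g j))
      simpa [hg i j hij hj] using this)
    m (by simp only [g0, gn, Equiv.symm_apply_apply]; rw [H.comm x m]; exact h)
  have h1 : d (φ m) (g j) ≤ L * R := by
    have := hφ m (φ.symm (g j))
    rw [Equiv.apply_symm_apply] at this
    exact this.trans (Nat.mul_le_mul_left _ hmj)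
  have h2 := hg 0 j (by omega) hj
  have h3 := hg j _ hj le_rfl
  rw [g0] at h2
  rw [gn] at h3
  have h4 := H.triangle (φ m) (g j) (φ x)
  have h5 := H.triangle (φ m) (g j) (φ y)
  have h6 := H.comm (g j) (φ x)
  omega

theorem exists_isCenter_map (H : IsHypMetric d δ) (φ : V ≃ V) (L κ : ℕ)
    (hφ : ∀ x y, d (φ x) (φ y) ≤ L * d x y) (hφ' : ∀ x y, d (φ.symm x) (φ.symm y) ≤ L * d x y) :
    ∃ κ', ∀ m x y z, IsCenter d κ m x y z → IsCenter d κ' (φ m) (φ x) (φ y) (φ z) := by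
  obtain ⟨κ', h⟩ := H.exists_product_map_le φ L κ hφ hφ'
  exact ⟨κ', fun m x y z hc => ⟨h _ _ _ hc.xy, h _ _ _ hc.yz, h _ _ _ hc.xz⟩⟩

end IsHypMetric

/-! ### Graph distances and Cayley graphs. -/

namespace SimpleGraph

variable {V W : Type*} {Γ : SimpleGraph V} {Γ' : SimpleGraph W}

theorem Walk.edist_map_le (f : V → W) (L : ℕ) (h : ∀ a b, Γ.Adj a b → Γ'.edist (f a) (f b) ≤ L)
    {a b : V} (w : Γ.Walk a b) : Γ'.edist (f a) (f b) ≤ (L * w.length : ℕ) := by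
  induction w with
  | nil => simp
  | cons hadj w ih =>
    refine SimpleGraph.edist_triangle.trans ((add_le_add (h _ _ hadj) ih).trans ?_)
    rw [Walk.length_cons]
    norm_cast
    rw [mul_add, mul_one, add_comm]

theorem edist_seq_le (g : ℕ → V) (L : ℕ) (i : ℕ) (n : ℕ)
    (h : ∀ s, i ≤ s → s < i + n → Γ.edist (g s) (g (s + 1)) ≤ L) :
    Γ.edist (g i) (g (i + n)) ≤ (L * n : ℕ) := by
  induction n with
  | zero => simp
  | succ n ih =>
    refine (SimpleGraph.edist_triangle (v := g (i + n))).trans ((add_le_add (ih fun s a b => h s a (by omega))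
      (h (i + n) (by omega) (by omega))).trans ?_)
    norm_cast

theorem Connected.edist_eq (h : Γ.Connected) (a b : V) : Γ.edist a b = (Γ.dist a b : ℕ) :=
  ((h a b).coe_dist_eq_edist).symm

theorem exists_walk_length_le_of_edist_le {a b : V} {n : ℕ} (h : Γ.edist a b ≤ n) :
    ∃ w : Γ.Walk a b, w.length ≤ n := by
  obtain ⟨w, hw⟩ := exists_walk_of_edist_ne_top (G := Γ) (u := a) (v := b)
    (ne_top_of_le_ne_top (ENat.natCast_ne_top n) h)
  refine ⟨w, ?_⟩
  rw [← hw] at h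
  exact_mod_cast h

theorem dist_le_of_edist_le {a b : V} {n : ℕ} (h : Γ.edist a b ≤ n) : Γ.dist a b ≤ n := by
  obtain ⟨w, hw⟩ := exists_walk_length_le_of_edist_le h
  exact (dist_le w).trans hw

theorem Connected.dist_map_le (hΓ : Γ.Connected) (f : V → W) (L : ℕ)
    (h : ∀ a b, Γ.Adj a b → Γ'.edist (f a) (f b) ≤ L) (a b : V) :
    Γ'.dist (f a) (f b) ≤ L * Γ.dist a b := by
  obtain ⟨w, hw⟩ := hΓ.exists_walk_length_eq_dist a b
  have := dist_le_of_edist_le (w.edist_map_le f L h)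
  rwa [hw] at this

theorem Connected.isHypMetric (hΓ : Γ.Connected) {δ : ℕ}
    (h4 : ∀ x y z t, Γ.dist x y + Γ.dist z t ≤
      max (Γ.dist x z + Γ.dist y t) (Γ.dist x t + Γ.dist y z) + 2 * δ) :
    IsHypMetric Γ.dist δ where
  eq_zero _ _ := hΓ.dist_eq_zero_iff
  comm _ _ := dist_comm
  triangle _ _ _ := hΓ.dist_triangle
  four := h4
  exists_between x y n hn := by
    obtain ⟨w, hw⟩ := hΓ.exists_walk_length_eq_dist x y
    have h1 := dist_le (w.take n)
    have h2 := dist_le (w.drop n)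
    have h3 := hΓ.dist_triangle (u := x) (v := w.getVert n) (w := y)
    rw [Walk.take_length] at h1
    rw [Walk.drop_length] at h2
    refine ⟨w.getVert n, ?_, ?_⟩ <;> omega

theorem finite_setOf_exists_walk (hfin : ∀ a, {b | Γ.Adj a b}.Finite) (n : ℕ) (a : V) :
    {b | ∃ w : Γ.Walk a b, w.length = n}.Finite := by
  induction n generalizing a with
  | zero =>
    refine (Set.finite_singleton a).subset ?_
    rintro b ⟨w, hw⟩
    exact (Walk.eq_of_length_eq_zero hw).symm
  | succ n ih =>
    refine ((hfin a).biUnion fun c _ => ih c).subset ?_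
    rintro b ⟨w, hw⟩
    cases w with
    | nil => simp at hw
    | cons h w =>
      simp only [Walk.length_cons, add_left_inj] at hw
      exact Set.mem_biUnion h ⟨w, hw⟩

theorem Connected.finite_setOf_dist_le (hΓ : Γ.Connected) (hfin : ∀ a, {b | Γ.Adj a b}.Finite)
    (a : V) (n : ℕ) : {b | Γ.dist a b ≤ n}.Finite := by
  refine ((Set.finite_Iic n).biUnion fun k _ => finite_setOf_exists_walk hfin k a).subset ?_
  intro b hb
  obtain ⟨w, hw⟩ := hΓ.exists_walk_length_eq_dist a b
  exact Set.mem_biUnion (x := Γ.dist a b) hb ⟨w, hw⟩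

section Cayley

variable {K : Type*} [Group K] {S : Set K}

theorem mulCayley_connected (hS : Subgroup.closure S = ⊤) : (mulCayley S).Connected := by
  have key : ∀ g : K, ∀ a, (mulCayley S).Reachable a (a * g) := by
    intro g
    have hg : g ∈ Subgroup.closure S := hS ▸ Subgroup.mem_top g
    induction hg using Subgroup.closure_induction with
    | mem x hx =>
      intro a
      by_cases h : a = a * x
      · rw [← h]
      · exact Adj.reachable ((mulCayley_adj S _ _).2 ⟨h, Or.inl (by simpa using hx)⟩)
    | one => intro a; rw [mul_one]
    | mul x y _ _ hx hy => intro a; rw [← mul_assoc]; exact (hx a).trans (hy _)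
    | inv x _ hx => intro a; simpa using (hx (a * x⁻¹)).symm
  have : Nonempty K := ⟨1⟩
  refine ⟨fun a b => ?_⟩
  simpa using key (a⁻¹ * b) a

theorem dist_mul_left_mulCayley (g a b : K) :
    (mulCayley S).dist (g * a) (g * b) = (mulCayley S).dist a b := by
  have h : ∀ g a b : K, (mulCayley S).edist (g * a) (g * b) ≤ (mulCayley S).edist a b := by
    intro g a b
    refine le_iInf fun w => ?_
    have := w.edist_map_le (Γ' := mulCayley S) (fun x => g * x) 1 fun a b hab => by
      rw [Nat.cast_one, edist_le_one_iff_adj_or_eq]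
      exact Or.inl (mulCayley_adj_mul_iff_right.2 hab)
    simpa using this
  have h2 : (mulCayley S).edist (g * a) (g * b) = (mulCayley S).edist a b := by
    refine le_antisymm (h _ _ _) ?_
    simpa using h g⁻¹ (g * a) (g * b)
  simp only [dist, h2]

theorem finite_neighbors_mulCayley (hS : S.Finite) (a : K) : {b | (mulCayley S).Adj a b}.Finite := by
  refine ((hS.image fun s => a * s).union (hS.image fun s => a * s⁻¹)).subset ?_
  intro b hb
  rcases ((mulCayley_adj S a b).1 hb).2 with h | h
  · exact Or.inl ⟨_, h, by simp⟩
  · exact Or.inr ⟨_, h, by simp⟩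

theorem finite_setOf_mulCayley_dist_le (hS : S.Finite) (hgen : Subgroup.closure S = ⊤) (a : K)
    (n : ℕ) : {b | (mulCayley S).dist a b ≤ n}.Finite :=
  (mulCayley_connected hgen).finite_setOf_dist_le (finite_neighbors_mulCayley hS) a n

theorem exists_dist_mulCayley_hom_le {G : Type*} [Group G] {T : Set G} (hS : S.Finite)
    (hgen : Subgroup.closure S = ⊤) (hgenT : Subgroup.closure T = ⊤) (φ : K →* G) :
    ∃ L : ℕ, ∀ a b, (mulCayley T).dist (φ a) (φ b) ≤ L * (mulCayley S).dist a b := by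
  obtain ⟨L, hL⟩ := (hS.image fun s => (mulCayley T).dist 1 (φ s)).bddAbove
  refine ⟨L, (mulCayley_connected hgen).dist_map_le φ L fun a b hab => ?_⟩
  rw [(mulCayley_connected hgenT).edist_eq]
  norm_cast
  rcases ((mulCayley_adj S a b).1 hab).2 with h | h
  · rw [← dist_mul_left_mulCayley (φ a)⁻¹, ← map_inv, ← map_mul, ← map_mul, inv_mul_cancel, map_one]
    exact hL ⟨_, h, rfl⟩
  · rw [dist_comm, ← dist_mul_left_mulCayley (φ b)⁻¹, ← map_inv, ← map_mul, ← map_mul,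
      inv_mul_cancel, map_one]
    exact hL ⟨_, h, rfl⟩

end Cayley

end SimpleGraph

/-! ### The electric metric on the group as a graph metric. -/

namespace RelHyp

open SimpleGraph

variable {K : Type*} [Group K]

/-- The Cayley graph together with all edges between elements of a left coset of `H` which is not
in `A`. -/
def cosetGraph (S : Set K) (H : Subgroup K) (A : Set (K ⧸ H)) : SimpleGraph K where
  Adj a b := (mulCayley S).Adj a b ∨ (a ≠ b ∧ (a : K ⧸ H) = b ∧ (a : K ⧸ H) ∉ A)
  symm := ⟨by
    rintro a b (h | ⟨h1, h2, h3⟩)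
    · exact Or.inl h.symm
    · exact Or.inr ⟨h1.symm, h2.symm, h2 ▸ h3⟩⟩
  loopless := ⟨by
    rintro a (h | ⟨h, -⟩)
    · exact (mulCayley S).loopless.irrefl a h
    · exact h rfl⟩

variable {S : Set K} {H : Subgroup K}

/-- This makes the electric metric left invariant and, for finite `H`, a word metric of a finite
generating set. -/
theorem cosetGraph_empty : cosetGraph S H ∅ = mulCayley (S ∪ H) := by
  ext a b
  have h1 : (b⁻¹ * a ∈ H) ↔ (a⁻¹ * b ∈ H) := by
    rw [← H.inv_mem_iff]
    simp
  simp only [cosetGraph, mulCayley_adj, QuotientGroup.eq, Set.mem_empty_iff_false, not_false_eq_true,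
    and_true, Set.mem_union, SetLike.mem_coe, h1]
  tauto

theorem closure_union_eq_top (hS : Subgroup.closure S = ⊤) :
    Subgroup.closure (S ∪ (H : Set K)) = ⊤ :=
  top_le_iff.1 (hS ▸ Subgroup.closure_mono Set.subset_union_left)

theorem cosetGraph_empty_connected (hS : Subgroup.closure S = ⊤) :
    (cosetGraph S H ∅).Connected := by
  rw [cosetGraph_empty]
  exact mulCayley_connected (closure_union_eq_top hS)

theorem conedOffGraph_adj_inl_inl {a b : K} (h : (mulCayley S).Adj a b) :
    (conedOffGraph S H).Adj (Sum.inl a) (Sum.inl b) := h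

theorem conedOffGraph_adj_inl_inr {a : K} {c : K ⧸ H} (h : (a : K ⧸ H) = c) :
    (conedOffGraph S H).Adj (Sum.inl a) (Sum.inr c) := h

theorem conedOffGraph_adj_inr_inl {a : K} {c : K ⧸ H} (h : (a : K ⧸ H) = c) :
    (conedOffGraph S H).Adj (Sum.inr c) (Sum.inl a) := h

theorem edgeLength_nonneg (x y : ConeVertex H) : 0 ≤ edgeLength x y := by
  unfold edgeLength
  split <;> norm_num

theorem electricLength_cons {x y z : ConeVertex H} (h : (conedOffGraph S H).Adj x y)
    (w : (conedOffGraph S H).Walk y z) :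
    electricLength (Walk.cons h w) = edgeLength x y + electricLength w := by
  simp [electricLength]

theorem electricLength_nil {x : ConeVertex H} :
    electricLength (Walk.nil : (conedOffGraph S H).Walk x x) = 0 := by
  simp [electricLength]

theorem electricLength_append {x y z : ConeVertex H} (v : (conedOffGraph S H).Walk x y)
    (w : (conedOffGraph S H).Walk y z) :
    electricLength (v.append w) = electricLength v + electricLength w := by
  simp [electricLength]

theorem electricLength_nonneg {x y : ConeVertex H} (w : (conedOffGraph S H).Walk x y) :
    0 ≤ electricLength w := by
  apply List.sum_nonneg
  simp only [List.mem_map]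
  rintro _ ⟨e, -, rfl⟩
  exact edgeLength_nonneg _ _

theorem electricDist_nonneg (x y : ConeVertex H) : 0 ≤ electricDist S H x y :=
  Real.iInf_nonneg electricLength_nonneg

theorem electricDist_le {x y : ConeVertex H} (w : (conedOffGraph S H).Walk x y) :
    electricDist S H x y ≤ electricLength w :=
  ciInf_le ⟨0, by rintro _ ⟨v, rfl⟩; exact electricLength_nonneg v⟩ w

/-- The induction passes through cone vertices, so these are treated at the same time: a cone vertex
may be replaced by any element of its coset at the cost of half an edge. -/
theorem dist_le_electricLength (hS : Subgroup.closure S = ⊤) (b : K) {x y : ConeVertex H}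
    (w : (conedOffGraph S H).Walk x y) (hy : y = Sum.inl b) :
    (∀ a, x = Sum.inl a → ((cosetGraph S H ∅).dist a b : ℝ) ≤ electricLength w) ∧
      (∀ a : K, x = Sum.inr (a : K ⧸ H) →
        ((cosetGraph S H ∅).dist a b : ℝ) ≤ electricLength w + 1 / 2) := by
  have hc := cosetGraph_empty_connected (H := H) hS
  induction w with
  | nil =>
    subst hy
    refine ⟨fun a ha => ?_, fun a ha => by simp at ha⟩
    obtain rfl := Sum.inl.inj ha
    simp [electricLength_nil]
  | @cons x z _ h w ih =>
    obtain ⟨ih1, ih2⟩ := ih hy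
    rw [electricLength_cons]
    refine ⟨fun a ha => ?_, fun a ha => ?_⟩
    · subst ha
      rcases z with a' | c
      · have h1 : (cosetGraph S H ∅).dist a a' = 1 := dist_eq_one_iff_adj.2 (Or.inl h)
        have h2 := hc.dist_triangle (u := a) (v := a') (w := b)
        have h3 := ih1 a' rfl
        have h4 : ((cosetGraph S H ∅).dist a b : ℝ) ≤ 1 + (cosetGraph S H ∅).dist a' b := by
          rw [h1] at h2
          exact_mod_cast h2
        simp only [edgeLength]
        linarith
      · have h1 : (a : K ⧸ H) = c := h
        have h3 := ih2 a (by rw [h1])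
        simp only [edgeLength]
        linarith
    · subst ha
      rcases z with a' | c
      · have h1 : (a' : K ⧸ H) = a := h
        have h2 : (cosetGraph S H ∅).dist a a' ≤ 1 := by
          by_cases e : a = a'
          · subst e
            simp
          · exact (dist_eq_one_iff_adj.2 (Or.inr ⟨e, h1.symm, by simp⟩)).le
        have h5 := hc.dist_triangle (u := a) (v := a') (w := b)
        have h3 := ih1 a' rfl
        have h4 : ((cosetGraph S H ∅).dist a b : ℝ) ≤ 1 + (cosetGraph S H ∅).dist a' b := by
          exact_mod_cast h5.trans (by omega)
        simp only [edgeLength]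
        linarith
      · exact h.elim

/-- A walk through the coset graph gives a walk through the coned-off graph, along the same
vertices of `K`. -/
theorem exists_conedOff_walk {A : Set (K ⧸ H)} {a b : K} (w : (cosetGraph S H A).Walk a b) :
    ∃ γ : (conedOffGraph S H).Walk (Sum.inl a) (Sum.inl b), electricLength γ ≤ w.length ∧
      ∀ v ∈ γ.support, (∃ u ∈ w.support, v = Sum.inl u) ∨ cosetOf v ∉ A := by
  induction w with
  | nil => exact ⟨Walk.nil, by simp [electricLength_nil], by simp⟩
  | @cons a a' b h w ih =>
    obtain ⟨γ, h1, h2⟩ := ih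
    rcases id h with h' | ⟨-, h3, h4⟩
    · refine ⟨Walk.cons (conedOffGraph_adj_inl_inl h') γ, ?_, ?_⟩
      · rw [electricLength_cons]
        simp only [edgeLength, Walk.length_cons]
        push_cast
        linarith
      · intro v hv
        rw [Walk.support_cons, List.mem_cons] at hv
        rcases hv with rfl | hv
        · exact Or.inl ⟨a, by simp, rfl⟩
        · rcases h2 v hv with ⟨u, hu, rfl⟩ | h2
          · exact Or.inl ⟨u, by simp [hu], rfl⟩
          · exact Or.inr h2
    · refine ⟨Walk.cons (conedOffGraph_adj_inl_inr rfl)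
        (Walk.cons (conedOffGraph_adj_inr_inl h3.symm) γ), ?_, ?_⟩
      · rw [electricLength_cons, electricLength_cons]
        simp only [edgeLength, Walk.length_cons]
        push_cast
        linarith
      · intro v hv
        rw [Walk.support_cons, List.mem_cons, Walk.support_cons, List.mem_cons] at hv
        rcases hv with rfl | rfl | hv
        · exact Or.inl ⟨a, by simp, rfl⟩
        · exact Or.inr h4
        · rcases h2 v hv with ⟨u, hu, rfl⟩ | h2
          · exact Or.inl ⟨u, by simp [hu], rfl⟩
          · exact Or.inr h2

theorem electricDist_inl (hS : Subgroup.closure S = ⊤) (a b : K) :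
    electricDist S H (Sum.inl a) (Sum.inl b) = (cosetGraph S H ∅).dist a b := by
  obtain ⟨w, hw⟩ := (cosetGraph_empty_connected (H := H) hS).exists_walk_length_eq_dist a b
  obtain ⟨γ, hγ, -⟩ := exists_conedOff_walk w
  refine le_antisymm ((electricDist_le γ).trans (hγ.trans (by rw [hw]))) ?_
  have : Nonempty ((conedOffGraph S H).Walk (Sum.inl a) (Sum.inl b)) := ⟨γ⟩
  exact le_ciInf fun v => (dist_le_electricLength hS b v rfl).1 a rfl

theorem IsWeaklyHyperbolic.exists_isHypMetric (hS : Subgroup.closure S = ⊤)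
    (h : IsWeaklyHyperbolic S H) : ∃ δ : ℕ, IsHypMetric (cosetGraph S H ∅).dist δ := by
  obtain ⟨δ, hδ⟩ := h
  refine ⟨⌈δ⌉₊, (cosetGraph_empty_connected hS).isHypMetric fun x y z t => ?_⟩
  have h1 := hδ (Sum.inl x) (Sum.inl y) (Sum.inl z) (Sum.inl t)
  simp only [electricDist_inl hS] at h1
  have h2 := Nat.le_ceil δ
  have h3 : (((cosetGraph S H ∅).dist x y + (cosetGraph S H ∅).dist z t : ℕ) : ℝ) ≤
      ((max ((cosetGraph S H ∅).dist x z + (cosetGraph S H ∅).dist y t)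
        ((cosetGraph S H ∅).dist x t + (cosetGraph S H ∅).dist y z) + 2 * ⌈δ⌉₊ : ℕ) : ℝ) := by
    push_cast
    linarith
  exact_mod_cast h3

end RelHyp

namespace SimpleGraph

theorem Walk.exists_split {V : Type*} {Γ : SimpleGraph V} {x y : V} (γ : Γ.Walk x y) {i j k : ℕ}
    (hij : i ≤ j) (hjk : j ≤ k) : ∃ (p : Γ.Walk x (γ.getVert i))
      (q : Γ.Walk (γ.getVert i) (γ.getVert j)) (r : Γ.Walk (γ.getVert j) (γ.getVert k))
      (s : Γ.Walk (γ.getVert k) y), γ = p.append (q.append (r.append s)) := by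
  have key : ∀ {x : V} (γ : Γ.Walk x y) {i j : ℕ}, i ≤ j → ∃ (q : Γ.Walk x (γ.getVert i))
      (r : Γ.Walk (γ.getVert i) (γ.getVert j)) (s : Γ.Walk (γ.getVert j) y),
      γ = q.append (r.append s) := by
    intro x γ i j hij
    -- The intermediate vertex is generalized to `z` because the vertices of `γ.drop i` agree with
    -- those of `γ` only up to a propositional equality.
    obtain ⟨z, hz, q, r, h⟩ : ∃ z, z = γ.getVert j ∧ ∃ (q : Γ.Walk (γ.getVert i) z)
        (r : Γ.Walk z y), γ.drop i = q.append r :=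
      ⟨_, by rw [Walk.drop_getVert]; congr 1; omega, (γ.drop i).take (j - i),
        (γ.drop i).drop (j - i), (Walk.append_take_drop_eq _ _).symm⟩
    subst hz
    exact ⟨γ.take i, q, r, by rw [← h, Walk.append_take_drop_eq]⟩
  obtain ⟨z, z', hz, hz', q, r, s, h⟩ : ∃ z z', z = γ.getVert j ∧ z' = γ.getVert k ∧
      ∃ (q : Γ.Walk (γ.getVert i) z) (r : Γ.Walk z z') (s : Γ.Walk z' y),
        γ.drop i = q.append (r.append s) :=
    ⟨_, _, by rw [Walk.drop_getVert]; congr 1; omega, by rw [Walk.drop_getVert]; congr 1; omega,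
      key (γ.drop i) (show j - i ≤ k - i by omega)⟩
  subst hz hz'
  exact ⟨γ.take i, q, r, s, by rw [← h, Walk.append_take_drop_eq]⟩

end SimpleGraph

/-! ### Bounded coset penetration for paths of bounded length. -/

namespace RelHyp

open SimpleGraph

variable {K : Type*} [Group K] {S : Set K} {H : Subgroup K}

/-- Twice the length of an edge. -/
def edgeWeight : ConeVertex H → ConeVertex H → ℕ
  | Sum.inl _, Sum.inl _ => 2
  | _, _ => 1

/-- Twice the length of an edge path. -/
def weight {x y : ConeVertex H} (γ : (conedOffGraph S H).Walk x y) : ℕ :=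
  (γ.darts.map fun e => edgeWeight e.fst e.snd).sum

theorem weight_cons {x y z : ConeVertex H} (h : (conedOffGraph S H).Adj x y)
    (w : (conedOffGraph S H).Walk y z) :
    weight (Walk.cons h w) = edgeWeight x y + weight w := by
  simp [weight]

theorem weight_nil {x : ConeVertex H} :
    weight (Walk.nil : (conedOffGraph S H).Walk x x) = 0 := by
  simp [weight]

theorem weight_append {x y z : ConeVertex H} (v : (conedOffGraph S H).Walk x y)
    (w : (conedOffGraph S H).Walk y z) : weight (v.append w) = weight v + weight w := by
  simp [weight]

theorem electricLength_eq_weight {x y : ConeVertex H} (w : (conedOffGraph S H).Walk x y) :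
    electricLength w = (weight w : ℝ) / 2 := by
  induction w with
  | nil => simp [electricLength_nil, weight_nil]
  | @cons x z _ h w ih =>
    rw [electricLength_cons, weight_cons, ih]
    rcases x with a | c <;> rcases z with b | e <;> simp [edgeLength, edgeWeight] <;> ring

theorem exists_shortcut {x y : ConeVertex H} (h : cosetOf x = cosetOf y) :
    ∃ σ : (conedOffGraph S H).Walk x y, weight σ ≤ 2 ∧
      ∀ v ∈ σ.support, v = x ∨ v = y ∨ (x ≠ y ∧ v = Sum.inr (cosetOf x)) := by
  by_cases hxy : x = y
  · subst hxy
    exact ⟨Walk.nil, by simp [weight_nil], by simp⟩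
  · rcases x with a | c <;> rcases y with b | e
    · refine ⟨Walk.cons (conedOffGraph_adj_inl_inr h)
        (Walk.cons (conedOffGraph_adj_inr_inl rfl) Walk.nil), ?_, ?_⟩
      · simp [weight_cons, weight_nil, edgeWeight]
      · simp only [Walk.support_cons, Walk.support_nil, List.mem_cons, List.not_mem_nil, or_false]
        rintro v (rfl | rfl | rfl)
        · exact Or.inl rfl
        · exact Or.inr (Or.inr ⟨hxy, by rw [h]⟩)
        · exact Or.inr (Or.inl rfl)
    · refine ⟨Walk.cons (conedOffGraph_adj_inl_inr (show (a : K ⧸ H) = e from h)) Walk.nil, ?_, ?_⟩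
      · simp [weight_cons, weight_nil, edgeWeight]
      · simp only [Walk.support_cons, Walk.support_nil, List.mem_cons, List.not_mem_nil, or_false]
        rintro v (rfl | rfl)
        · exact Or.inl rfl
        · exact Or.inr (Or.inl rfl)
    · refine ⟨Walk.cons (conedOffGraph_adj_inr_inl (show (b : K ⧸ H) = c from h.symm)) Walk.nil,
        ?_, ?_⟩
      · simp [weight_cons, weight_nil, edgeWeight]
      · simp only [Walk.support_cons, Walk.support_nil, List.mem_cons, List.not_mem_nil, or_false]
        rintro v (rfl | rfl)
        · exact Or.inl rfl
        · exact Or.inr (Or.inl rfl)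
    · exact (hxy (congrArg Sum.inr h)).elim

/-- Edges at a cone vertex stay inside its coset, so changing coset takes an edge of the Cayley
graph. -/
theorem two_le_weight {x y : ConeVertex H} (w : (conedOffGraph S H).Walk x y)
    (h : cosetOf x ≠ cosetOf y) : 2 ≤ weight w := by
  induction w with
  | nil => exact (h rfl).elim
  | @cons x z y hadj w ih =>
    rw [weight_cons]
    by_cases hz : cosetOf z = cosetOf y
    · rw [← hz] at h
      rcases x with a | c <;> rcases z with b | e
      · simp [edgeWeight]
      · exact (h hadj).elim
      · exact (h (show (b : K ⧸ H) = c from hadj).symm).elim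
      · exact hadj.elim
    · have := ih hz
      omega

/-- A subpath that leaves a coset and returns has weight at least `4` and is replaced by a shortcut
of weight at most `2`; the weight is a natural number, so this terminates. No shortcut passes
through the cone vertex of `c`, since both of its ends would then be `a`. -/
theorem exists_withoutBacktracking {a : K} {c : K ⧸ H} {x y : ConeVertex H}
    (γ : (conedOffGraph S H).Walk x y) (hγ : ∀ v ∈ γ.support, cosetOf v = c → v = Sum.inl a) :
    ∃ γ' : (conedOffGraph S H).Walk x y, weight γ' ≤ weight γ ∧ WithoutBacktracking γ' ∧
      ∀ v ∈ γ'.support, cosetOf v = c → v = Sum.inl a := by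
  induction hn : weight γ using Nat.strong_induction_on generalizing γ with
  | _ n ih =>
    subst hn
    by_cases hb : WithoutBacktracking γ
    · exact ⟨γ, le_rfl, hb, hγ⟩
    · simp only [WithoutBacktracking, not_forall] at hb
      obtain ⟨i, j, k, hij, hjk, hk, hik, hj⟩ := hb
      obtain ⟨p, q1, q2, r, hpqr⟩ := γ.exists_split hij hjk
      have hw : weight p + 4 + weight r ≤ weight γ := by
        have h0 := congrArg weight hpqr
        simp only [weight_append] at h0
        have h1 := two_le_weight q1 fun e => hj e.symm
        have h2 := two_le_weight q2 (by rw [← hik]; exact hj)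
        omega
      obtain ⟨σ, hσ1, hσ2⟩ := exists_shortcut (S := S) hik
      have hlt : weight (p.append (σ.append r)) < weight γ := by
        rw [weight_append, weight_append]
        omega
      have hgood : ∀ v ∈ (p.append (σ.append r)).support, cosetOf v = c → v = Sum.inl a := by
        intro v hv hvc
        have hsub : v ∈ p.support ∨ v ∈ r.support → v ∈ γ.support := by
          intro hv
          have := congrArg (v ∈ ·.support) hpqr
          simp only [Walk.mem_support_append_iff, eq_iff_iff] at this
          tauto
        simp only [Walk.mem_support_append_iff] at hv
        rcases hv with hv | hv | hv
        · exact hγ v (hsub (Or.inl hv)) hvc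
        · rcases hσ2 v hv with rfl | rfl | ⟨hne, rfl⟩
          · exact hγ _ (Walk.getVert_mem_support _ _) hvc
          · exact hγ _ (Walk.getVert_mem_support _ _) hvc
          · refine (hne ?_).elim
            rw [hγ _ (Walk.getVert_mem_support _ _) hvc,
              hγ _ (Walk.getVert_mem_support _ _) (hik.symm.trans hvc)]
        · exact hγ v (hsub (Or.inr hv)) hvc
      obtain ⟨γ', h1, h2, h3⟩ := ih _ hlt _ hgood rfl
      exact ⟨γ', h1.trans hlt.le, h2, h3⟩

theorem isElectricQuasigeodesic_of_length_le {x y : ConeVertex H} {P : ℝ} (hP : 0 ≤ P)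
    (γ : (conedOffGraph S H).Walk x y) (h : electricLength γ ≤ P) :
    IsElectricQuasigeodesic P γ := by
  intro a b γ₁ γ₂ γ₃ hγ
  have h1 := electricLength_nonneg γ₁
  have h2 := electricLength_nonneg γ₃
  have h3 := mul_nonneg hP (electricDist_nonneg (S := S) a b)
  rw [hγ, electricLength_append, electricLength_append] at h
  linarith

/-- An excursion out of a coset, of bounded length, returns close to where it started. -/
theorem BoundedCosetPenetration.exists_excursion_le (h : BoundedCosetPenetration S H) (J : ℕ) :
    ∃ D : ℕ, ∀ (a b u : K), (a : K ⧸ H) = b → a ≠ b → (mulCayley S).Adj u b →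
      ∀ w : (cosetGraph S H {(a : K ⧸ H)}).Walk a u, w.length ≤ J →
        (∀ v ∈ w.support, (v : K ⧸ H) = a → v = a) → (u : K ⧸ H) ≠ a → wordDist S a b ≤ D := by
  obtain ⟨D, hD⟩ := h (J + 2) (by have : (0 : ℝ) ≤ J := Nat.cast_nonneg J; linarith)
  refine ⟨⌈D⌉₊, fun a b u hab hne hub w hw hsupp hu => ?_⟩
  obtain ⟨γ, hγ1, hγ2⟩ := exists_conedOff_walk w
  -- The path `β` avoids the cone vertex of `a H`, while `α` runs from `a` through that vertex to
  -- `b` and then to `u`. Both have length at most `J + 2`, so both are quasigeodesics for that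
  -- constant, and `a`, `b` are the entry and exit points of `α`.
  obtain ⟨β, hβ1, hβ2, hβ3⟩ := exists_withoutBacktracking (a := a) (c := (a : K ⧸ H)) γ (by
    intro v hv hvc
    rcases hγ2 v hv with ⟨z, hz, rfl⟩ | h
    · rw [hsupp z hz hvc]
    · exact (h hvc).elim)
  let α : (conedOffGraph S H).Walk (Sum.inl a) (Sum.inl u) :=
    Walk.cons (conedOffGraph_adj_inl_inr rfl)
      (Walk.cons (conedOffGraph_adj_inr_inl hab.symm)
        (Walk.cons (conedOffGraph_adj_inl_inl hub.symm) Walk.nil))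
  have hJ : (w.length : ℝ) ≤ J := by exact_mod_cast hw
  have hJ0 : (0 : ℝ) ≤ J := Nat.cast_nonneg J
  have hα : electricLength α = 2 := by
    simp only [α, electricLength_cons, electricLength_nil, edgeLength]
    norm_num
  have hαv : ∀ n, cosetOf (α.getVert n) = (a : K ⧸ H) ↔ n ≤ 2 := by
    intro n
    rcases n with _ | _ | _ | n
    · simp [α, cosetOf]
    · simp [α, cosetOf]
    · simp [α, cosetOf, hab]
    · simp [α, cosetOf, hu]
  have hβ4 : electricLength β ≤ electricLength γ := by
    rw [electricLength_eq_weight, electricLength_eq_weight]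
    have : (weight β : ℝ) ≤ weight γ := by exact_mod_cast hβ1
    linarith
  have key := (hD a u α β
    (isElectricQuasigeodesic_of_length_le (by linarith) _ (by rw [hα]; linarith)) ?_
    (isElectricQuasigeodesic_of_length_le (by linarith) _ (by linarith)) hβ2 a ?_).1 ?_ a b ?_ ?_
  · exact_mod_cast key.trans (Nat.le_ceil D)
  · intro i j k hij hjk hk hik
    have hlen : α.length = 3 := rfl
    by_cases hk2 : k ≤ 2
    · rw [(hαv j).2 (by omega), (hαv i).2 (by omega)]
    · have hi2 : ¬ i ≤ 2 := by
        rw [← hαv, hik, hαv]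
        exact hk2
      rw [show j = i by omega]
  · simp [Penetrates, α]
  · intro hp
    simpa using hβ3 _ hp rfl
  · exact ⟨0, Nat.zero_le _, rfl, rfl, by simp⟩
  · refine ⟨1, ?_, rfl, hab.symm, ?_⟩
    · simp [α]
    · intro j hj
      obtain rfl : j = 0 := by omega
      simpa [cosetOf] using hu

/-- Elements of a coset which are joined by a short path without edges in that coset are close in
the word metric. -/
theorem BoundedCosetPenetration.exists_wordDist_le (hS : Subgroup.closure S = ⊤)
    (h : BoundedCosetPenetration S H) (J : ℕ) :
    ∃ D : ℕ, ∀ a b : K, (a : K ⧸ H) = b →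
      (cosetGraph S H {(a : K ⧸ H)}).edist a b ≤ J → wordDist S a b ≤ D := by
  obtain ⟨D, hD⟩ := h.exists_excursion_le J
  suffices key : ∀ n, n ≤ J → ∀ a b : K, (a : K ⧸ H) = b →
      ∀ w : (cosetGraph S H {(a : K ⧸ H)}).Walk a b, w.length ≤ n →
        wordDist S a b ≤ n * (D + 1) by
    refine ⟨J * (D + 1), fun a b hab hd => ?_⟩
    obtain ⟨w, hw⟩ := exists_walk_length_le_of_edist_le hd
    exact key J le_rfl a b hab w hw
  intro n
  induction n using Nat.strong_induction_on with
  | _ n ih =>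
    intro hn a b hab w hw
    have hconn := mulCayley_connected hS
    by_cases hne : a = b
    · subst hne
      simp [wordDist]
    have hlen : w.length ≠ 0 := fun h0 => hne (Walk.eq_of_length_eq_zero h0)
    -- Cut the path at its first return `t` to the coset. The edge arriving there comes from the
    -- Cayley graph, because the edges inside this coset have been removed; the part after `t` is
    -- handled by induction.
    obtain ⟨t, ⟨ht1, htw, htc⟩, hmin⟩ : ∃ t, (1 ≤ t ∧ t ≤ w.length ∧
        (w.getVert t : K ⧸ H) = a) ∧ ∀ s < t, ¬ (1 ≤ s ∧ s ≤ w.length ∧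
          (w.getVert s : K ⧸ H) = a) := by
      classical
      have hex : ∃ t, 1 ≤ t ∧ t ≤ w.length ∧ (w.getVert t : K ⧸ H) = a :=
        ⟨w.length, by omega, le_rfl, by rw [Walk.getVert_length, hab]⟩
      exact ⟨Nat.find hex, Nat.find_spec hex, fun s hs => Nat.find_min hex hs⟩
    have hfirst : wordDist S a (w.getVert t) ≤ D + 1 := by
      have hedge := w.adj_getVert_succ (i := t - 1) (by omega)
      rw [Nat.sub_add_cancel ht1] at hedge
      have hadj : (mulCayley S).Adj (w.getVert (t - 1)) (w.getVert t) := by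
        rcases hedge with h | ⟨-, h1, h2⟩
        · exact h
        · exact (h2 (by rw [h1, htc]; rfl)).elim
      rcases Nat.eq_or_lt_of_le ht1 with h1 | h1
      · rw [← h1] at hadj ⊢
        simp only [Nat.sub_self, Walk.getVert_zero] at hadj
        have : wordDist S a (w.getVert 1) = 1 := dist_eq_one_iff_adj.2 hadj
        omega
      · by_cases ha : a = w.getVert t
        · rw [← ha]
          simp [wordDist]
        · refine (hD a (w.getVert t) (w.getVert (t - 1)) htc.symm ha hadj (w.take (t - 1)) ?_ ?_
            ?_).trans (Nat.le_succ D)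
          · rw [Walk.take_length]
            omega
          · intro v hv hva
            obtain ⟨s, rfl, hs⟩ := Walk.mem_support_iff_exists_getVert.1 hv
            rw [Walk.take_length] at hs
            rw [Walk.take_getVert, min_eq_right (by omega)] at hva ⊢
            by_contra hs0
            exact hmin s (by omega) ⟨Nat.one_le_iff_ne_zero.2 fun h0 => hs0 (by simp [h0]),
              by omega, hva⟩
          · intro hu
            exact hmin (t - 1) (by omega) ⟨by omega, by omega, hu⟩
    have hrest : wordDist S (w.getVert t) b ≤ (n - 1) * (D + 1) := by
      have := ih (n - 1) (by omega) (by omega) (w.getVert t) b (htc.trans hab)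
      rw [htc] at this
      refine this (w.drop t) ?_
      rw [Walk.drop_length]
      omega
    calc wordDist S a b ≤ wordDist S a (w.getVert t) + wordDist S (w.getVert t) b :=
          hconn.dist_triangle
      _ ≤ (D + 1) + (n - 1) * (D + 1) := add_le_add hfirst hrest
      _ = (n - 1 + 1) * (D + 1) := by ring
      _ = n * (D + 1) := by rw [Nat.sub_add_cancel (by omega)]

end RelHyp

/-! ### Shortest paths between cosets. -/

namespace RelHyp

open SimpleGraph

variable {K : Type*} [Group K] {S : Set K} {H : Subgroup K}

/-- The constant `L + 1` covers both kinds of edges, also when `L = 0`. With `ψ = id` it says that a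
path without edges inside the cosets of `B` survives their removal. -/
theorem edist_cosetGraph_map_le (hS : Subgroup.closure S = ⊤) {ψ : K → K} {L : ℕ}
    (hL : ∀ a b, wordDist S (ψ a) (ψ b) ≤ L * wordDist S a b)
    (hc : ∀ a b : K, (a : K ⧸ H) = b → (ψ a : K ⧸ H) = ψ b) {A B : Set (K ⧸ H)} {a b : K}
    (hab : (cosetGraph S H A).Adj a b) (hB : (a : K ⧸ H) = b → (ψ a : K ⧸ H) ∉ B) :
    (cosetGraph S H B).edist (ψ a) (ψ b) ≤ (L + 1 : ℕ) := by
  rcases hab with h | ⟨-, h1, -⟩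
  · have h1 : (cosetGraph S H B).edist (ψ a) (ψ b) ≤ (mulCayley S).edist (ψ a) (ψ b) :=
      edist_anti fun a b h => Or.inl h
    refine h1.trans ?_
    rw [(mulCayley_connected hS).edist_eq]
    have h2 := hL a b
    have h3 : wordDist S a b = 1 := dist_eq_one_iff_adj.2 h
    rw [h3, mul_one] at h2
    exact_mod_cast h2.trans (Nat.le_succ L)
  · by_cases e : ψ a = ψ b
    · rw [e]
      simp
    · have h2 : (cosetGraph S H B).Adj (ψ a) (ψ b) := Or.inr ⟨e, hc _ _ h1, hB h1⟩
      rw [edist_eq_one_iff_adj.2 h2]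
      exact_mod_cast Nat.succ_le_succ (Nat.zero_le L)

/-- The distance of `m` and `n` is the electric distance of their cosets. -/
def IsClosestPair (S : Set K) (H : Subgroup K) (m n : K) : Prop :=
  ∀ x y : K, (x : K ⧸ H) = m → (y : K ⧸ H) = n →
    (cosetGraph S H ∅).dist m n ≤ (cosetGraph S H ∅).dist x y

/-- Geodesics between two cosets and between their images under a coset-preserving bilipschitz
bijection have nearby starting points. -/
theorem exists_wordDist_closest_le (hS : Subgroup.closure S = ⊤)
    (hbcp : BoundedCosetPenetration S H) {δ : ℕ} (hyp : IsHypMetric (cosetGraph S H ∅).dist δ)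
    (ψ : K ≃ K) (hψ : ∀ x y : K, (ψ x : K ⧸ H) = ψ y ↔ (x : K ⧸ H) = y) {L : ℕ}
    (h1 : ∀ x y, wordDist S (ψ x) (ψ y) ≤ L * wordDist S x y)
    (h2 : ∀ x y, wordDist S (ψ.symm x) (ψ.symm y) ≤ L * wordDist S x y) :
    ∃ D, ∀ m n m' n' : K, (m : K ⧸ H) ≠ n → IsClosestPair S H m n → IsClosestPair S H m' n' →
      (m' : K ⧸ H) = ψ m → (n' : K ⧸ H) = ψ n → wordDist S (ψ m) m' ≤ D := by
  have hconn := cosetGraph_empty_connected (H := H) hS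
  have hψ' : ∀ x y : K, (ψ.symm x : K ⧸ H) = ψ.symm y ↔ (x : K ⧸ H) = y := by
    intro x y
    rw [← hψ]
    simp
  obtain ⟨R, hR⟩ := hyp.exists_near_of_quasigeodesic (L + 1) 2
  -- The three summands bound the pieces of a path from `m` to `ψ.symm m'` without edges in the
  -- coset of `m`: along `g` to `g T`, across to the pulled-back geodesic, and back along the
  -- latter.
  obtain ⟨D, hD⟩ := hbcp.exists_wordDist_le hS
    (2 * (2 * R + 2) + (2 * R + 1) + (L + 1) * ((L + 1) * (3 * R + 4)))
  refine ⟨L * D, fun m n m' n' hmn hcl hcl' hm hn => ?_⟩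
  set d := (cosetGraph S H ∅).dist with hd
  have hle1 : ∀ x y : K, (x : K ⧸ H) = y → d x y ≤ 1 := by
    intro x y hxy
    by_cases e : x = y
    · subst e
      simp [hd]
    · exact (dist_eq_one_iff_adj.2 (Or.inr ⟨e, hxy, by simp⟩)).le
  have hadj : ∀ x y : K, d x y = 1 → (cosetGraph S H ∅).Adj x y :=
    fun x y h => dist_eq_one_iff_adj.1 h
  obtain ⟨g, g0, gN, hg⟩ := hyp.exists_geodesic m n
  obtain ⟨f, f0, fN, hf⟩ := hyp.exists_geodesic m' n'
  set N := d m n with hN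
  set N' := d m' n' with hN'
  have hc0 : (ψ.symm (f 0) : K ⧸ H) = m := by
    rw [f0, ← hψ, Equiv.apply_symm_apply]
    exact hm
  have hcN : (ψ.symm (f N') : K ⧸ H) = n := by
    rw [fN, ← hψ, Equiv.apply_symm_apply]
    exact hn
  have hstep : ∀ x y, d (ψ x) (ψ y) ≤ (L + 1) * d x y :=
    hconn.dist_map_le ψ (L + 1) fun a b hab =>
      edist_cosetGraph_map_le hS h1 (fun a b h => (hψ a b).2 h) hab (by simp)
  have hstep' : ∀ x y, d (ψ.symm x) (ψ.symm y) ≤ (L + 1) * d x y :=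
    hconn.dist_map_le ψ.symm (L + 1) fun a b hab =>
      edist_cosetGraph_map_le hS h2 (fun a b h => (hψ' a b).2 h) hab (by simp)
  have hquasi : ∀ i j, i ≤ j → j ≤ N' → j - i ≤ (L + 1) * d (ψ.symm (f i)) (ψ.symm (f j)) := by
    intro i j hij hj
    have := hstep (ψ.symm (f i)) (ψ.symm (f j))
    simpa only [Equiv.apply_symm_apply, hf i j hij hj] using this
  -- Beyond time `2 * R + 2` a bridge of length `R` starting on `g` cannot reach the coset of `m`.
  -- If `g` is shorter than that, the bridge lies in the coset of `n` instead.
  obtain ⟨T, hT1, hT2, hT3⟩ : ∃ T, T ≤ N ∧ T ≤ 2 * R + 2 ∧ (T < N → T = 2 * R + 2) :=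
    ⟨min N (2 * R + 2), min_le_left _ _, min_le_right _ _, by omega⟩
  have hgT : d m (g T) = T := by rw [← g0, hg 0 T (by omega) hT1]; omega
  have hTg : d (g T) n = N - T := by
    have := hg T N hT1 le_rfl
    rwa [gN] at this
  have hfar : N ≤ d (ψ.symm (f 0)) (ψ.symm (f N')) := hcl _ _ hc0 hcN
  obtain ⟨j, hj, hj1, hj2⟩ : ∃ j ≤ N', (cosetGraph S H {(m : K ⧸ H)}).edist (g T) (ψ.symm (f j)) ≤
      (2 * R + 1 : ℕ) ∧ d (g T) (ψ.symm (f j)) ≤ R + 1 := by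
    rcases Nat.eq_or_lt_of_le hT1 with hTN | hTN
    · refine ⟨N', le_rfl, ?_, ?_⟩
      · rw [hTN, gN]
        by_cases e : n = ψ.symm (f N')
        · rw [← e]
          simp
        · have : (cosetGraph S H {(m : K ⧸ H)}).Adj n (ψ.symm (f N')) :=
            Or.inr ⟨e, hcN.symm, fun h => hmn h.symm⟩
          rw [edist_eq_one_iff_adj.2 this]
          exact_mod_cast Nat.succ_le_succ (Nat.zero_le _)
      · rw [hTN, gN]
        exact (hle1 _ _ hcN.symm).trans (by omega)
    · obtain ⟨j, hj, hjR⟩ := hR (fun j => ψ.symm (f j)) N'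
        (fun j hj => (hstep' _ _).trans (by rw [hf j (j + 1) (by omega) hj]; simp)) hquasi (g T) (by
          have a1 := hconn.dist_triangle (u := ψ.symm (f 0)) (v := m) (w := g T)
          have a2 := hconn.dist_triangle (u := g T) (v := n) (w := ψ.symm (f N'))
          have a3 := hle1 _ _ hc0
          have a4 := hle1 _ _ hcN.symm
          simp only [← hd] at *
          omega)
      refine ⟨j, hj, ?_, hjR.trans (Nat.le_succ R)⟩
      obtain ⟨e, e0, eN, he⟩ := hyp.exists_geodesic (g T) (ψ.symm (f j))
      have := edist_seq_le (Γ := cosetGraph S H {(m : K ⧸ H)}) e 2 0 (d (g T) (ψ.symm (f j)))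
        fun s _ hs => by
          refine edist_cosetGraph_map_le (ψ := id) (L := 1) hS (by simp) (fun _ _ h => h)
            (hadj _ _ (by rw [he s (s + 1) (by omega) (by omega)]; omega)) fun _ hsm => ?_
          have b1 := hcl (e s) n hsm rfl
          have b2 := he 0 s (by omega) (by omega)
          have b3 := hconn.dist_triangle (u := e s) (v := g T) (w := n)
          have b4 := hyp.comm (e 0) (e s)
          simp only [← hd] at *
          rw [e0] at b2 b4
          have := hT3 hTN
          omega
      rw [zero_add, e0, eN] at this
      refine this.trans ?_
      exact_mod_cast (show 2 * d (g T) (ψ.symm (f j)) ≤ 2 * R + 1 by omega)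
  -- An edge of `g` inside the coset of `m` would let a path start one step later, against
  -- minimality. The same argument applies to `f` and `m'` below.
  have hE1 : (cosetGraph S H {(m : K ⧸ H)}).edist m (g T) ≤ (2 * (2 * R + 2) : ℕ) := by
    have := edist_seq_le (Γ := cosetGraph S H {(m : K ⧸ H)}) g 2 0 T fun s _ hs => by
      refine edist_cosetGraph_map_le (ψ := id) (L := 1) hS (by simp) (fun _ _ h => h)
        (hadj _ _ (by rw [hg s (s + 1) (by omega) (by omega)]; omega)) fun hss hsm => ?_
      have b1 := hcl (g (s + 1)) n (hss.symm.trans hsm) rfl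
      have b2 := hg (s + 1) N (by omega) le_rfl
      rw [gN] at b2
      simp only [← hd] at *
      omega
    rw [zero_add, g0] at this
    refine this.trans ?_
    exact_mod_cast Nat.mul_le_mul_left 2 hT2
  have hjle : j ≤ (L + 1) * (3 * R + 4) := by
    have b1 := hquasi 0 j (by omega) hj
    have b2 := hconn.dist_triangle (u := ψ.symm (f 0)) (v := m) (w := ψ.symm (f j))
    have b3 := hconn.dist_triangle (u := m) (v := g T) (w := ψ.symm (f j))
    have b4 := hle1 _ _ hc0
    simp only [← hd] at *
    exact b1.trans (Nat.mul_le_mul_left _ (by omega))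
  have hE3 : (cosetGraph S H {(m : K ⧸ H)}).edist (ψ.symm (f 0)) (ψ.symm (f j)) ≤
      ((L + 1) * ((L + 1) * (3 * R + 4)) : ℕ) := by
    have := edist_seq_le (Γ := cosetGraph S H {(m : K ⧸ H)}) (fun s => ψ.symm (f s)) (L + 1) 0 j
      fun s _ hs => by
        refine edist_cosetGraph_map_le (ψ := ψ.symm) hS h2 (fun a b h => (hψ' a b).2 h)
          (hadj _ _ (by rw [hf s (s + 1) (by omega) (by omega)]; omega)) fun hss hsm => ?_
        have b0 : (f s : K ⧸ H) = m' := by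
          have b : (ψ.symm (f s) : K ⧸ H) = m := hsm
          rwa [← hψ, Equiv.apply_symm_apply, ← hm] at b
        have b1 := hcl' (f (s + 1)) n' (hss.symm.trans b0) rfl
        have b2 := hf (s + 1) N' (by omega) le_rfl
        rw [fN] at b2
        simp only [← hd] at *
        omega
    rw [zero_add] at this
    exact this.trans (by exact_mod_cast Nat.mul_le_mul_left _ hjle)
  have hfinal := hD m (ψ.symm (f 0)) hc0.symm (by
    refine SimpleGraph.edist_triangle.trans ((add_le_add (SimpleGraph.edist_triangle.trans
      (add_le_add hE1 hj1)) (SimpleGraph.edist_comm.trans_le hE3)).trans ?_)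
    norm_cast)
  have := h1 m (ψ.symm (f 0))
  rw [Equiv.apply_symm_apply, f0] at this
  rw [f0] at hfinal
  exact this.trans (Nat.mul_le_mul_left _ hfinal)

theorem edist_cosetGraph_le_wordDist (hS : Subgroup.closure S = ⊤) (A : Set (K ⧸ H)) (a b : K) :
    (cosetGraph S H A).edist a b ≤ wordDist S a b := by
  rw [wordDist, ← (mulCayley_connected hS).edist_eq]
  exact edist_anti fun a b h => Or.inl h

/-- If `n ∉ H`, every `h ∈ H` is reached from `1` through `n` and `h * n`, where the middle edge
lies in the coset `n H ≠ H`. The length of this path does not depend on `h`, so `H` would lie in a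
ball. -/
theorem BoundedCosetPenetration.mem_of_normalizes (hS : Subgroup.closure S = ⊤) (hfin : S.Finite)
    (hbcp : BoundedCosetPenetration S H) (hinf : (H : Set K).Infinite) {n : K}
    (hn : ∀ h ∈ H, n⁻¹ * h * n ∈ H) : n ∈ H := by
  by_contra hcon
  obtain ⟨D, hD⟩ := hbcp.exists_wordDist_le hS (wordDist S 1 n + 1 + wordDist S n 1)
  refine hinf ((finite_setOf_mulCayley_dist_le hfin hS 1 D).subset fun h hh => ?_)
  have h1 : ((1 : K) : K ⧸ H) = h := QuotientGroup.eq.2 (by simpa using hh)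
  refine hD 1 h h1 ?_
  have e1 := edist_cosetGraph_le_wordDist (H := H) hS {((1 : K) : K ⧸ H)} 1 n
  have e3 := edist_cosetGraph_le_wordDist (H := H) hS {((1 : K) : K ⧸ H)} (h * n) h
  have e4 : wordDist S (h * n) h = wordDist S n 1 := by
    have := dist_mul_left_mulCayley (S := S) h n 1
    rwa [mul_one] at this
  rw [e4] at e3
  have e2 : (cosetGraph S H {((1 : K) : K ⧸ H)}).edist n (h * n) ≤ 1 := by
    rw [edist_le_one_iff_adj_or_eq]
    by_cases e : n = h * n
    · exact Or.inr e
    · refine Or.inl (Or.inr ⟨e, QuotientGroup.eq.2 (by simpa [mul_assoc] using hn h hh), ?_⟩)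
      intro h2
      exact hcon (by simpa using QuotientGroup.eq.1 (Set.mem_singleton_iff.1 h2).symm)
  refine SimpleGraph.edist_triangle.trans ((add_le_add (SimpleGraph.edist_triangle.trans
    (add_le_add e1 e2)) e3).trans ?_)
  norm_cast

theorem isClosestPair_mul_left {m n : K} (h : IsClosestPair S H m n) (k : K) :
    IsClosestPair S H (k * m) (k * n) := by
  intro x y hx hy
  have := h (k⁻¹ * x) (k⁻¹ * y)
    (by rw [QuotientGroup.eq] at hx ⊢; simpa [mul_assoc] using hx)
    (by rw [QuotientGroup.eq] at hy ⊢; simpa [mul_assoc] using hy)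
  rw [cosetGraph_empty] at *
  rw [dist_mul_left_mulCayley] at *
  exact this

theorem exists_isClosestPair (S : Set K) (H : Subgroup K) (x₀ y₀ : K) :
    ∃ x y : K, (x : K ⧸ H) = x₀ ∧ (y : K ⧸ H) = y₀ ∧ IsClosestPair S H x y := by
  classical
  have hex : ∃ n, ∃ x y : K, (x : K ⧸ H) = x₀ ∧ (y : K ⧸ H) = y₀ ∧
      (cosetGraph S H ∅).dist x y = n := ⟨_, x₀, y₀, rfl, rfl, rfl⟩
  obtain ⟨x, y, hx, hy, hxy⟩ := Nat.find_spec hex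
  refine ⟨x, y, hx, hy, fun x' y' hx' hy' => ?_⟩
  rw [hxy]
  exact Nat.find_min' hex ⟨x', y', hx'.trans hx, hy'.trans hy, rfl⟩

end RelHyp

/-! ### From a transversal to a section, and the transversal for infinite `K₁`. -/

namespace RelHyp

open SimpleGraph

theorem exists_conjAut {K G : Type*} [Group K] [Group G] (i : K →* G)
    (hi : Function.Injective i) (hn : i.range.Normal) :
    ∃ Φ : G →* MulAut K, ∀ g k, i (Φ g k) = g * i k * g⁻¹ := by
  refine ⟨(MulAut.congr (i.ofInjective hi).symm).toMonoidHom.comp MulAut.conjNormal, fun g k => ?_⟩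
  have h : ∀ x : i.range, i ((i.ofInjective hi).symm x) = x := by
    intro x
    rw [← MonoidHom.ofInjective_apply hi, MulEquiv.apply_symm_apply]
  simp [MulAut.congr, h, MulAut.conjNormal_apply, MonoidHom.ofInjective_apply]

/-- A set of representatives of `G ⧸ K` which varies coarsely continuously gives a quasi-isometric
section. -/
theorem exists_section_of_transversal {K G Q : Type*} [Group K] [Group G] [Group Q]
    (i : K →* G) (p : G →* Q) (hp : Function.Surjective p) (hip : i.range = p.ker)
    (A : Set G) (hA : ∀ q, ∃ a ∈ A, p a = q)
    (hfin : ∀ t : G, {k : K | ∃ a ∈ A, a * t * i k ∈ A}.Finite) :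
    ∃ s : Q → G, ∀ S : Finset G, Subgroup.closure (S : Set G) = ⊤ →
      ∀ T : Finset Q, Subgroup.closure (T : Set Q) = ⊤ →
        ∃ R ε : ℝ, 1 ≤ R ∧ 0 ≤ ε ∧
          IsQuasiIsometricSection p (S : Set G) (T : Set Q) R ε s := by
  choose s hsA hsp using hA
  refine ⟨s, fun S hS T hT => ?_⟩
  obtain ⟨L, hL⟩ := exists_dist_mulCayley_hom_le S.finite_toSet hS hT p
  choose l hl using hp
  -- Finitely many generators, each with finitely many possible jumps `l t * i k`: their lengths
  -- have a common bound `M`.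
  have hfin' : (⋃ t ∈ (T : Set Q), (fun k => wordDist (S : Set G) 1 (l t * i k)) ''
      {k : K | ∃ a ∈ A, a * l t * i k ∈ A}).Finite :=
    T.finite_toSet.biUnion fun t _ => (hfin (l t)).image _
  obtain ⟨M, hM⟩ := hfin'.bddAbove
  have hstep : ∀ q t, t ∈ T → wordDist (S : Set G) (s q) (s (q * t)) ≤ M := by
    intro q t ht
    have hker : (s q * l t)⁻¹ * s (q * t) ∈ i.range := by
      rw [hip, MonoidHom.mem_ker]
      simp [hsp, hl]
    obtain ⟨k, hk⟩ := hker
    have h1 : s (q * t) = s q * (l t * i k) := by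
      rw [hk]
      group
    have h2 : wordDist (S : Set G) (s q) (s (q * t)) = wordDist (S : Set G) 1 (l t * i k) := by
      have := dist_mul_left_mulCayley (S := (S : Set G)) (s q) 1 (l t * i k)
      rwa [mul_one, ← h1] at this
    rw [h2]
    refine hM (Set.mem_biUnion (x := t) ht ⟨k, ⟨s q, hsA q, ?_⟩, rfl⟩)
    rw [mul_assoc, ← h1]
    exact hsA _
  have hlip : ∀ q q', wordDist (S : Set G) (s q) (s q') ≤ M * wordDist (T : Set Q) q q' := by
    refine (mulCayley_connected hT).dist_map_le s M fun a b hab => ?_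
    rw [(mulCayley_connected hS).edist_eq]
    norm_cast
    rcases ((mulCayley_adj (T : Set Q) a b).1 hab).2 with h | h
    · simpa [wordDist] using hstep a _ h
    · rw [SimpleGraph.dist_comm]
      simpa [wordDist] using hstep b _ h
  have hlow : ∀ q q', wordDist (T : Set Q) q q' ≤ L * wordDist (S : Set G) (s q) (s q') := by
    intro q q'
    simpa [hsp, wordDist] using hL (s q) (s q')
  refine ⟨(L : ℝ) + M + 1, 0, ?_, le_rfl, hsp, fun q q' => ⟨?_, ?_⟩⟩
  · have : (0 : ℝ) ≤ L := Nat.cast_nonneg L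
    have : (0 : ℝ) ≤ M := Nat.cast_nonneg M
    linarith
  · have h1 : (wordDist (T : Set Q) q q' : ℝ) ≤ L * wordDist (S : Set G) (s q) (s q') := by
      exact_mod_cast hlow q q'
    have h2 : (0 : ℝ) ≤ wordDist (S : Set G) (s q) (s q') := Nat.cast_nonneg _
    have h3 : (0 : ℝ) ≤ (M + 1) * wordDist (S : Set G) (s q) (s q') := by positivity
    rw [sub_zero, one_div, inv_mul_le_iff₀ (by positivity)]
    linarith
  · have h1 : (wordDist (S : Set G) (s q) (s q') : ℝ) ≤ M * wordDist (T : Set Q) q q' := by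
      exact_mod_cast hlip q q'
    have h3 : (0 : ℝ) ≤ (L + 1) * wordDist (T : Set Q) q q' := by positivity
    linarith

/-- Normalizing the starting point of a shortest path between two cosets to be `1` picks out a
bounded part of each coset of `K` in `G`. -/
theorem exists_transversal_of_infinite {K G : Type*} [Group K] [Group G]
    (i : K →* G) (hi : Function.Injective i) (hn : i.range.Normal)
    (K₁ : Subgroup K) (hproper : K₁ ≠ ⊤) (hrel : IsStronglyHyperbolic K K₁)
    (hcusps : PreservesCusps i K₁) (hinf : (K₁ : Set K).Infinite) :
    ∃ A : Set G, (∀ g, ∃ k, g * i k ∈ A) ∧ ∀ t : G, {k : K | ∃ a ∈ A, a * t * i k ∈ A}.Finite := by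
  obtain ⟨-, S, hS, hweak, hbcp⟩ := hrel
  obtain ⟨δ, hyp⟩ := hweak.exists_isHypMetric hS
  obtain ⟨Φ, hΦ⟩ := exists_conjAut i hi hn
  obtain ⟨b, hb⟩ : ∃ b, b ∉ K₁ := by
    by_contra! h
    exact hproper ((Subgroup.eq_top_iff' K₁).2 h)
  set M := K₁.map i with hM
  have hlam : ∀ x y : K, MulAut.conj (i x) • M = MulAut.conj (i y) • M ↔ (x : K ⧸ K₁) = y := by
    have aux : ∀ n : K, MulAut.conj (i n) • M = M ↔ n ∈ K₁ := by
      intro n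
      constructor
      · intro h
        refine hbcp.mem_of_normalizes hS S.finite_toSet hinf fun k hk => ?_
        have h1 : i k ∈ MulAut.conj (i n) • M := by
          rw [h]
          exact Subgroup.mem_map_of_mem i hk
        rw [Subgroup.mem_pointwise_smul_iff_inv_smul_mem] at h1
        obtain ⟨k', hk', e⟩ := h1
        have : k' = n⁻¹ * k * n := hi (by rw [e]; simp [← map_inv])
        rwa [← this]
      · intro h
        exact Subgroup.conj_smul_eq_self_of_mem (Subgroup.mem_map_of_mem i h)
    intro x y
    rw [QuotientGroup.eq, ← aux, map_mul, map_mul, mul_smul, map_inv, map_inv, inv_smul_eq_iff]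
    exact eq_comm
  choose κ hκ' using hcusps
  have hκ : ∀ g, MulAut.conj g • M = MulAut.conj (i (κ g)) • M := hκ'
  have hmul : ∀ x y : G, MulAut.conj (x * y) • M = MulAut.conj x • MulAut.conj y • M := by
    intro x y
    rw [map_mul, mul_smul]
  -- The conjugate of `K₁` by `t * i x` is its conjugate by `Φ t x * κ t`, so `ψ t` realizes the
  -- action of `t` on cosets by a bijection of `K`.
  let ψ : G → K ≃ K := fun t => (Φ t).toEquiv.trans (Equiv.mulRight (κ t))
  have hψa : ∀ t x, ψ t x = Φ t x * κ t := fun _ _ => rfl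
  have hψlam : ∀ t x, MulAut.conj (i (ψ t x)) • M = MulAut.conj (t * i x) • M := by
    intro t x
    rw [hψa, map_mul, map_mul, mul_smul, ← hκ, ← mul_smul, ← map_mul, hΦ]
    simp
  have hψc : ∀ t (x y : K), (ψ t x : K ⧸ K₁) = ψ t y ↔ (x : K ⧸ K₁) = y := by
    intro t x y
    rw [← hlam, hψlam, hψlam, ← hlam, map_mul, map_mul, mul_smul, mul_smul, smul_left_cancel_iff]
  have hconn := mulCayley_connected hS
  have hpos : ∀ x y : K, x ≠ y → 1 ≤ wordDist (S : Set K) x y :=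
    fun x y h => hconn.pos_dist_of_ne h
  -- Both `ψ t` and its inverse are a right translation followed by a homomorphism. A right
  -- translation changes distances by a bounded amount, which is absorbed since distinct elements
  -- are at distance at least `1`.
  have hlip : ∀ (φ : K →* K) (u v : K → K) (C : ℕ), (∀ x, v x = φ (u x)) →
      (∀ x y, wordDist (S : Set K) (u x) (u y) ≤ wordDist (S : Set K) x y + C) →
      ∃ L, ∀ x y, wordDist (S : Set K) (v x) (v y) ≤ L * wordDist (S : Set K) x y := by
    intro φ u v C hv hu
    obtain ⟨L, hL⟩ := exists_dist_mulCayley_hom_le S.finite_toSet hS hS φ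
    refine ⟨L * (1 + C), fun x y => ?_⟩
    by_cases e : x = y
    · subst e
      simp [wordDist]
    · rw [hv, hv, mul_assoc]
      refine (hL _ _).trans (Nat.mul_le_mul_left _ ((hu x y).trans ?_))
      have := hpos x y e
      nlinarith
  have hright : ∀ k x y : K, wordDist (S : Set K) (x * k) (y * k) ≤
      wordDist (S : Set K) x y + 2 * wordDist (S : Set K) 1 k := by
    intro k x y
    have e1 := hconn.dist_triangle (u := x * k) (v := x) (w := y * k)
    have e2 := hconn.dist_triangle (u := x) (v := y) (w := y * k)
    have e3 := dist_mul_left_mulCayley (S := (S : Set K)) x k 1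
    have e4 := dist_mul_left_mulCayley (S := (S : Set K)) y 1 k
    have e5 := SimpleGraph.dist_comm (G := mulCayley (S : Set K)) (u := k) (v := 1)
    rw [mul_one] at e3 e4
    simp only [wordDist]
    omega
  have hnat : ∀ t, ∃ D, ∀ m n m' n' : K, (m : K ⧸ K₁) ≠ n → IsClosestPair (S : Set K) K₁ m n →
      IsClosestPair (S : Set K) K₁ m' n' → (m' : K ⧸ K₁) = ψ t m → (n' : K ⧸ K₁) = ψ t n →
      wordDist (S : Set K) (ψ t m) m' ≤ D := by
    intro t
    obtain ⟨L₁, hL₁⟩ := hlip (Φ t).toMonoidHom (fun x => x * (Φ t).symm (κ t)) (ψ t) _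
      (fun x => by simp [hψa]) (hright _)
    obtain ⟨L₂, hL₂⟩ := hlip (Φ t).symm.toMonoidHom (fun x => x * (κ t)⁻¹) (ψ t).symm _
      (fun x => by rw [Equiv.symm_apply_eq, hψa]; simp) (hright _)
    exact exists_wordDist_closest_le hS hbcp hyp (ψ t) (hψc t) (L := L₁ + L₂)
      (fun x y => (hL₁ x y).trans (Nat.mul_le_mul_right _ (by omega)))
      (fun x y => (hL₂ x y).trans (Nat.mul_le_mul_right _ (by omega)))
  refine ⟨{g | ∃ n, IsClosestPair (S : Set K) K₁ 1 n ∧ M = MulAut.conj g⁻¹ • M ∧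
    MulAut.conj (i n) • M = MulAut.conj (g⁻¹ * i b) • M}, fun g => ?_, fun t => ?_⟩
  -- Take a closest pair for the cosets `g⁻¹ · K₁` and `g⁻¹ · b K₁`; left translation by `x⁻¹` moves
  -- its first point to `1`, so `g * i x` belongs to the set.
  · obtain ⟨x, y, hx, hy, hxy⟩ := exists_isClosestPair (S : Set K) K₁ (κ g⁻¹) (κ (g⁻¹ * i b))
    refine ⟨x, x⁻¹ * y, by simpa using isClosestPair_mul_left hxy x⁻¹, ?_, ?_⟩
    · rw [← hlam, ← hκ] at hx
      rw [mul_inv_rev, map_mul, mul_smul, ← hx, ← mul_smul, ← map_mul]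
      simp
    · rw [← hlam, ← hκ] at hy
      rw [mul_inv_rev, map_mul, map_mul, mul_smul, hy, ← mul_smul, ← map_mul, map_inv, mul_assoc]
  · obtain ⟨D, hD⟩ := hnat t⁻¹
    refine (finite_setOf_mulCayley_dist_le S.finite_toSet hS (ψ t⁻¹ 1) D).subset ?_
    rintro k ⟨a, ⟨n, hn1, hn2, hn3⟩, ⟨n', hn1', hn2', hn3'⟩⟩
    -- Since `i k * (a * t * i k)⁻¹ = t⁻¹ * a⁻¹`, the pair `(k, k * n')` is a closest pair for the
    -- images under `ψ t⁻¹` of the cosets of `1` and `n`; hence `k` is close to `ψ t⁻¹ 1`.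
    refine hD 1 n k (k * n') ?_ hn1 (by simpa using isClosestPair_mul_left hn1' k) ?_ ?_
    · rw [Ne, ← hlam, hn3, hmul, map_one, map_one, one_smul]
      intro h
      have h2 := hn2.symm.trans h
      rw [map_inv, smul_left_cancel_iff] at h2
      have h3 := (hlam 1 b).1 (by simpa using h2)
      exact hb (by simpa using QuotientGroup.eq.1 h3)
    · rw [← hlam, hψlam, map_one, mul_one]
      conv_lhs => rw [hn2', ← hmul]
      conv_rhs => rw [hn2, ← hmul]
      congr 2
      group
    · rw [← hlam, hψlam, map_mul, hmul, hn3', ← hmul, hmul t⁻¹, hn3, ← hmul]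
      congr 2
      group

end RelHyp

/-! ### Hyperbolic groups: loxodromic elements, large triples, and the transversal for finite `K₁`.
-/

theorem IsCenter.mono {V : Type*} {d : V → V → ℕ} {κ κ' : ℕ} {m x y z : V}
    (h : IsCenter d κ m x y z) (hκ : κ ≤ κ') : IsCenter d κ' m x y z :=
  ⟨h.xy.trans (by omega), h.yz.trans (by omega), h.xz.trans (by omega)⟩

namespace RelHyp

open SimpleGraph

section Triples

variable {K : Type*} [Group K] {d : K → K → ℕ} {δ : ℕ}

/-- A long geodesic contains two distant subsegments which are translates of each other. -/
theorem exists_translate_along_geodesic (H : IsHypMetric d δ)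
    (hinv : ∀ g a b, d (g * a) (g * b) = d a b) (hball : ∀ n, {g | d 1 g ≤ n}.Finite) [Infinite K]
    (L : ℕ) : ∃ h u, L ≤ d 1 h ∧ d 1 u = L ∧ d u h + L = d 1 h ∧ d 1 (h * u) = d 1 h + L := by
  set C := (hball L).toFinset.card with hC
  obtain ⟨y, hy⟩ : ∃ y, d 1 y = (C + 1) * L := by
    obtain ⟨y, hy⟩ := (hball ((C + 1) * L)).infinite_compl.nonempty
    simp only [Set.mem_compl_iff, Set.mem_ofPred_eq, not_le] at hy
    obtain ⟨z, hz, -⟩ := H.exists_between 1 y _ hy.le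
    exact ⟨z, hz⟩
  obtain ⟨f, -, -, hf⟩ := H.exists_geodesic 1 y
  rw [hy] at hf
  have hmul : ∀ s, s ≤ C → s * L + L ≤ (C + 1) * L := by
    intro s hs
    calc s * L + L = (s + 1) * L := by ring
      _ ≤ _ := Nat.mul_le_mul_right _ (by omega)
  have hd : ∀ a b, d 1 (a⁻¹ * b) = d a b := by
    intro a b
    rw [← hinv a 1, mul_one, mul_inv_cancel_left]
  -- Pigeonhole: `C + 1` consecutive segments of length `L`, translated to start at `1`, end in a
  -- ball with `C` elements.
  obtain ⟨s, hs, s', hs', hne, heq⟩ := Finset.exists_ne_map_eq_of_card_lt_of_maps_to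
    (s := Finset.range (C + 1)) (t := (hball L).toFinset)
    (f := fun s => (f (s * L))⁻¹ * f (s * L + L)) (by simp [hC]) (by
      intro s hs
      simp only [Finset.coe_range, Set.mem_Iio] at hs
      simp only [Set.Finite.coe_toFinset, Set.mem_ofPred_eq, hd]
      rw [hf _ _ (by omega) (hmul s (by omega))]
      omega)
  simp only [Finset.mem_range] at hs hs'
  wlog hlt : s < s' generalizing s s'
  · exact this s' s hne.symm heq.symm hs' hs (by omega)
  have h1 : s * L + L ≤ s' * L := by
    calc s * L + L = (s + 1) * L := by ring
      _ ≤ _ := Nat.mul_le_mul_right _ (by omega)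
  have h2 := hmul s' (by omega)
  have e1 := hf (s * L) (s' * L) (by omega) (by omega)
  have e2 := hf (s * L) (s * L + L) (by omega) (by omega)
  have e3 := hf (s * L + L) (s' * L) (by omega) (by omega)
  have e4 := hf (s * L) (s' * L + L) (by omega) (by omega)
  refine ⟨(f (s * L))⁻¹ * f (s' * L), (f (s * L))⁻¹ * f (s * L + L), ?_, ?_, ?_, ?_⟩
  · rw [hd]
    omega
  · rw [hd]
    omega
  · rw [hinv, hd]
    omega
  · change (f (s * L))⁻¹ * f (s * L + L) = (f (s' * L))⁻¹ * f (s' * L + L) at heq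
    rw [heq, mul_assoc, mul_inv_cancel_left, hd, hd]
    omega

/-- An infinite hyperbolic group has an element whose powers form a quasigeodesic. -/
theorem exists_loxodromic (H : IsHypMetric d δ) (hinv : ∀ g a b, d (g * a) (g * b) = d a b)
    (hball : ∀ n, {g | d 1 g ≤ n}.Finite) [Infinite K] :
    ∃ (h : K) (B : ℕ), (∀ k, k ≤ d 1 (h ^ k)) ∧
      ∀ a b : ℕ, d 1 (h ^ a) + d 1 (h ^ b) ≤ d 1 (h ^ (a + b)) + B := by
  obtain ⟨h, u, h1, h2, h3, h4⟩ := exists_translate_along_geodesic H hinv hball (5 * δ + 1)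
  have hpow : ∀ a b, d (h ^ a) (h ^ (a + b)) = d 1 (h ^ b) := by
    intro a b
    rw [pow_add, ← hinv (h ^ a) 1, mul_one]
  have hself := H.self
  -- A geodesic from `1` to `h` starts through `u`, and one from `1` to `h * u` passes through `h`;
  -- so there is almost no cancellation in `h * h`. The choice `5 * δ + 1` makes the gain per step,
  -- `d 1 h - 4 * δ`, at least `1` in `hsucc`.
  have hsq : 2 * d 1 h ≤ d 1 (h ^ 2) + 2 * δ := by
    have e1 := H.four 1 (h * u) h (h ^ 2)
    have e2 := hpow 1 1
    have e3 := hinv h 1 u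
    have e4 := hinv h u h
    rw [pow_one, one_add_one_eq_two] at e2
    rw [mul_one] at e3
    rw [← pow_two] at e4
    rw [H.comm (h * u) h] at e1
    omega
  have hsucc : ∀ k, d 1 (h ^ k) + d 1 h ≤ d 1 (h ^ (k + 1)) + 4 * δ := by
    intro k
    induction k with
    | zero => simp [hself]
    | succ k ih =>
      have e1 := H.four (h ^ k) (h ^ (k + 2)) 1 (h ^ (k + 1))
      have e2 := hpow k 1
      have e3 := hpow (k + 1) 1
      have e4 := hpow k 2
      have e5 := H.comm (h ^ k) 1
      have e6 := H.comm (h ^ (k + 2)) 1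
      have e7 := H.comm (h ^ (k + 2)) (h ^ (k + 1))
      rw [pow_one] at e2 e3
      rw [show k + 1 + 1 = k + 2 by ring] at e3 ⊢
      omega
  refine ⟨h, 6 * δ, fun k => ?_, fun a b => ?_⟩
  · induction k with
    | zero => exact Nat.zero_le _
    | succ k ih =>
      have := hsucc k
      omega
  · rcases b with _ | b
    · simp [hself]
    · have e1 := H.four 1 (h ^ (a + 1)) (h ^ a) (h ^ (a + (b + 1)))
      have e2 := hpow a 1
      have e3 := hpow a (b + 1)
      have e4 := hpow (a + 1) b
      have e5 := H.comm (h ^ (a + 1)) (h ^ a)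
      have e6 := hsucc a
      have e7 := hsucc b
      rw [pow_one] at e2
      rw [show a + 1 + b = a + (b + 1) by ring] at e4
      omega

/-- If `1` is a closest point to `w` among the powers of `h`, then the Gromov products of `w` with
these powers are bounded. -/
theorem product_pow_le (H : IsHypMetric d δ) (hinv : ∀ g a b, d (g * a) (g * b) = d a b)
    {h : K} {B : ℕ} (hB : ∀ a b : ℕ, d 1 (h ^ a) + d 1 (h ^ b) ≤ d 1 (h ^ (a + b)) + B)
    {w : K} (hw : ∀ j : ℕ, d 1 w ≤ d w (h ^ j)) (N : ℕ) :
    d 1 w + d 1 (h ^ N) ≤ d w (h ^ N) + 2 * (d 1 h + B + 2 * δ) := by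
  classical
  have hex : ∃ j, d 1 w + d 1 (h ^ N) ≤ d w (h ^ N) + 2 * d 1 (h ^ j) :=
    ⟨N, by have := H.triangle 1 (h ^ N) w; have := H.comm w (h ^ N); omega⟩
  -- `h ^ j` is the first power whose distance from `1` reaches the Gromov product of `w` and `h ^
  -- N`, and it exceeds this product by at most `d 1 h`. If it were far from `1`, it would be closer
  -- to `w` than `1` is.
  obtain ⟨j, hj, hmin⟩ : ∃ j, d 1 w + d 1 (h ^ N) ≤ d w (h ^ N) + 2 * d 1 (h ^ j) ∧
      ∀ k < j, ¬ d 1 w + d 1 (h ^ N) ≤ d w (h ^ N) + 2 * d 1 (h ^ k) :=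
    ⟨Nat.find hex, Nat.find_spec hex, fun k hk => Nat.find_min hex hk⟩
  have hjN : j ≤ N := by
    by_contra hlt
    refine hmin N (by omega) ?_
    have := H.triangle 1 (h ^ N) w
    have := H.comm w (h ^ N)
    omega
  rcases Nat.eq_zero_or_pos j with rfl | hpos
  · rw [pow_zero, H.self] at hj
    omega
  have e1 := hmin (j - 1) (by omega)
  have e2 := H.triangle 1 (h ^ (j - 1)) (h ^ j)
  have e3 : d (h ^ (j - 1)) (h ^ j) = d 1 h := by
    rw [← hinv (h ^ (j - 1)) 1 h, mul_one, ← pow_succ, Nat.sub_add_cancel hpos]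
  have e4 := hB j (N - j)
  have e5 : d (h ^ j) (h ^ N) = d 1 (h ^ (N - j)) := by
    rw [← hinv (h ^ j) 1, mul_one, ← pow_add, Nat.add_sub_cancel' hjN]
  rw [Nat.add_sub_cancel' hjN] at e4
  have e6 := H.four w (h ^ N) (h ^ j) 1
  have e7 := hw j
  have e8 := H.comm (h ^ j) 1
  have e9 := H.comm (h ^ N) 1
  have e10 := H.comm (h ^ N) (h ^ j)
  have e11 := H.comm w 1
  have e12 := H.triangle w 1 (h ^ N)
  have e13 := H.four w (h ^ j) (h ^ N) 1
  omega

/-- A hyperbolic group which is not virtually cyclic contains arbitrarily large triples with a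
center at `1`. -/
theorem exists_large_triples (H : IsHypMetric d δ) (hinv : ∀ g a b, d (g * a) (g * b) = d a b)
    (hball : ∀ n, {g | d 1 g ≤ n}.Finite) (hK : ¬ IsElementary K) :
    ∃ B, ∀ n, ∃ x y z, n ≤ d 1 x ∧ n ≤ d 1 y ∧ n ≤ d 1 z ∧ IsCenter d B 1 x y z := by
  have : Infinite K := by
    by_contra hfin
    rw [not_infinite_iff_finite] at hfin
    exact hK ⟨⊥, inferInstance, inferInstance⟩
  obtain ⟨h, B, hk, hB⟩ := exists_loxodromic H hinv hball
  refine ⟨2 * (d 1 h + B + 2 * δ), fun n => ?_⟩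
  -- If every element were within `n` of the powers of `h`, these would have finite index.
  -- Translating the nearest power to `1` gives the triple formed by the translate of `z`, `h ^ n`
  -- and `h⁻¹ ^ n`.
  obtain ⟨z, hz⟩ : ∃ z, ∀ k : ℤ, n < d z (h ^ k) := by
    by_contra! hcon
    refine hK ⟨Subgroup.zpowers h, inferInstance, ?_⟩
    have hfinite : Finite (K ⧸ Subgroup.zpowers h) := by
      refine Set.finite_univ_iff.1 (((hball n).image
        fun b => ((b⁻¹ : K) : K ⧸ Subgroup.zpowers h)).subset ?_)
      rintro q -
      obtain ⟨z, rfl⟩ := QuotientGroup.mk_surjective q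
      obtain ⟨k, hk⟩ := hcon z⁻¹
      refine ⟨(h ^ k)⁻¹ * z⁻¹, ?_, ?_⟩
      · rw [Set.mem_ofPred_eq, ← hinv (h ^ k), mul_one, mul_inv_cancel_left, H.comm]
        exact hk
      · refine QuotientGroup.eq.2 ?_
        simp only [mul_inv_rev, inv_inv, mul_assoc]
        simp [← zpow_neg]
    exact Subgroup.finiteIndex_of_finite_quotient
  obtain ⟨k, hmin⟩ : ∃ k : ℤ, ∀ j : ℤ, d z (h ^ k) ≤ d z (h ^ j) := by
    classical
    have hex : ∃ r, ∃ k : ℤ, d z (h ^ k) = r := ⟨_, 0, rfl⟩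
    obtain ⟨k, hk⟩ := Nat.find_spec hex
    exact ⟨k, fun j => hk ▸ Nat.find_min' hex ⟨j, rfl⟩⟩
  have hd1 : d 1 ((h ^ k)⁻¹ * z) = d z (h ^ k) := by
    rw [← hinv (h ^ k), mul_one, mul_inv_cancel_left, H.comm]
  have hdj : ∀ j : ℤ, d 1 ((h ^ k)⁻¹ * z) ≤ d ((h ^ k)⁻¹ * z) (h ^ j) := by
    intro j
    rw [hd1, ← hinv (h ^ k) _ (h ^ j), mul_inv_cancel_left, ← zpow_add]
    exact hmin _
  have hinvpow : ∀ a : ℕ, d 1 (h⁻¹ ^ a) = d 1 (h ^ a) := by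
    intro a
    rw [← hinv (h ^ a), mul_one, inv_pow, mul_inv_cancel, H.comm]
  have e1 := product_pow_le H hinv hB (w := (h ^ k)⁻¹ * z)
    (fun j => by simpa using hdj j) n
  have e2 := product_pow_le H hinv (h := h⁻¹) (B := B) (by simpa only [hinvpow] using hB)
    (w := (h ^ k)⁻¹ * z) (fun j => by simpa using hdj (-j)) n
  have e3 := hinvpow 1
  rw [pow_one, pow_one] at e3
  refine ⟨(h ^ k)⁻¹ * z, h ^ n, h⁻¹ ^ n, ?_, hk n, by rw [hinvpow]; exact hk n, e1, ?_, ?_⟩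
  · rw [hd1]
    exact (hz k).le
  · have e4 := hB n n
    have e5 : d (h ^ n) (h⁻¹ ^ n) = d 1 (h ^ (n + n)) := by
      rw [← hinv (h ^ n), inv_pow, mul_inv_cancel, ← pow_add, H.comm]
    rw [e5, hinvpow]
    omega
  · rw [e3] at e2
    exact e2

end Triples

/-- The triples play the role of three points at infinity, and a center is required for almost all
indices of an ultrafilter. This avoids the boundary of `K`. -/
theorem exists_transversal_of_isHypMetric {K G : Type*} [Group K] [Group G]
    (i : K →* G) (hi : Function.Injective i) (hn : i.range.Normal) (hK : ¬ IsElementary K)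
    {X : Set K} (hX : X.Finite) (hgen : Subgroup.closure X = ⊤) {δ : ℕ}
    (H : IsHypMetric (mulCayley X).dist δ) :
    ∃ A : Set G, (∀ g, ∃ k, g * i k ∈ A) ∧ ∀ t : G, {k : K | ∃ a ∈ A, a * t * i k ∈ A}.Finite := by
  obtain ⟨Φ, hΦ⟩ := exists_conjAut i hi hn
  have hball : ∀ n, {g | (mulCayley X).dist 1 g ≤ n}.Finite :=
    finite_setOf_mulCayley_dist_le hX hgen 1
  have hinv : ∀ g a b, (mulCayley X).dist (g * a) (g * b) = (mulCayley X).dist a b :=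
    dist_mul_left_mulCayley
  have hlip : ∀ g, ∃ L, ∀ a b, (mulCayley X).dist (Φ g a) (Φ g b) ≤ L * (mulCayley X).dist a b :=
    fun g => exists_dist_mulCayley_hom_le hX hgen hgen (Φ g).toMonoidHom
  generalize (mulCayley X).dist = d at H hball hinv hlip
  have hconj : ∀ k x, Φ (i k) x = k * x * k⁻¹ := fun k x => hi (by simp [hΦ])
  obtain ⟨B, hB⟩ := exists_large_triples H hinv hball hK
  choose x y z hx hy hz hxyz using hB
  have hmap : ∀ g κ, ∃ κ', ∀ m a b c, IsCenter d κ m a b c →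
      IsCenter d κ' (Φ g m) (Φ g a) (Φ g b) (Φ g c) := by
    intro g κ
    obtain ⟨L₁, h1⟩ := hlip g
    obtain ⟨L₂, h2⟩ := hlip g⁻¹
    refine H.exists_isCenter_map (Φ g).toEquiv (L₁ + L₂) κ
      (fun a b => (h1 a b).trans (Nat.mul_le_mul_right _ (by omega))) fun a b => ?_
    rw [map_inv] at h2
    exact (h2 a b).trans (Nat.mul_le_mul_right _ (by omega))
  let 𝒰 : Ultrafilter ℕ := Filter.hyperfilter ℕ
  let Cen : ℕ → G → K → Prop := fun κ g m =>
    ∀ᶠ n in (𝒰 : Filter ℕ), IsCenter d κ m (Φ g (x n)) (Φ g (y n)) (Φ g (z n))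
  -- The images of the triples have `1` as a center with a constant depending on `g`, so their good
  -- centers stay in a finite ball, and the ultrafilter selects one of them. Its constant no longer
  -- depends on `g`.
  have hexists : ∀ g, ∃ m, Cen (2 * δ + 2) g m := by
    intro g
    choose m hm using fun n => H.exists_isCenter (Φ g (x n)) (Φ g (y n)) (Φ g (z n))
    obtain ⟨κ, hκ⟩ := hmap g B
    have hbd : ∀ n, m n ∈ {k | d 1 k ≤ max κ (2 * δ + 2) + 2 * δ} := by
      intro n
      have h1 := (hκ _ _ _ _ (hxyz n)).mono (le_max_left κ (2 * δ + 2))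
      rw [map_one] at h1
      exact H.dist_isCenter_le h1 ((hm n).mono (le_max_right _ _))
    have hmem : {k | d 1 k ≤ max κ (2 * δ + 2) + 2 * δ} ∈ 𝒰.map m :=
      Ultrafilter.mem_map.2 (Filter.univ_mem' hbd)
    obtain ⟨k, -, hk⟩ := (𝒰.map m).eq_pure_of_finite_mem (hball _) hmem
    refine ⟨k, ?_⟩
    have h2 : ∀ᶠ n in (𝒰 : Filter ℕ), m n = k := by
      have : {k} ∈ 𝒰.map m := by
        rw [hk]
        exact Set.mem_singleton k
      exact this
    filter_upwards [h2] with n hn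
    rw [← hn]
    exact hm n
  have hunique : ∀ g κ m m', Cen κ g m → Cen κ g m' → d m m' ≤ κ + 2 * δ := by
    intro g κ m m' h h'
    obtain ⟨n, h1, h2⟩ := (h.and h').exists
    exact H.dist_isCenter_le h1 h2
  have hmapCen : ∀ g κ, ∃ κ', ∀ g' m, Cen κ g' m → Cen κ' (g * g') (Φ g m) := by
    intro g κ
    obtain ⟨κ', h⟩ := hmap g κ
    refine ⟨κ', fun g' m hm => ?_⟩
    filter_upwards [hm] with n hn
    simp only [map_mul, MulAut.mul_apply]
    exact h _ _ _ _ hn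
  have hfar : ∀ g m C, ∀ᶠ n in (𝒰 : Filter ℕ), ∀ w, n ≤ d 1 w → C < d m (Φ g w) := by
    intro g m C
    obtain ⟨L, hL⟩ := hlip g⁻¹
    have : ∀ᶠ n in (𝒰 : Filter ℕ), L * (d 1 m + C) < n :=
      Filter.Eventually.filter_mono Nat.hyperfilter_le_atTop (Filter.eventually_gt_atTop _)
    filter_upwards [this] with n hn w hw
    by_contra! hcon
    have h1 := hL 1 (Φ g w)
    rw [map_inv, MulAut.inv_apply_self, map_one] at h1
    have h2 := H.triangle 1 m (Φ g w)
    have h3 : L * d 1 (Φ g w) ≤ L * (d 1 m + C) := Nat.mul_le_mul_left _ (by omega)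
    omega
  -- Conjugation by `k` differs from left translation by at most `d 1 k⁻¹`, which is negligible for
  -- triples far from the center.
  have htrans : ∀ k g κ m, Cen κ g m → Cen (κ + 4 * δ) (i k * g) (k * m) := by
    intro k g κ m hm
    filter_upwards [hm, hfar g m (κ + 4 * δ + 2 * d 1 k⁻¹)] with n hn hfn
    have hc : IsCenter d κ (k * m) (k * Φ g (x n)) (k * Φ g (y n)) (k * Φ g (z n)) :=
      ⟨by simpa only [hinv] using hn.xy, by simpa only [hinv] using hn.yz,
        by simpa only [hinv] using hn.xz⟩
    have hnear : ∀ w, d (k * w) (k * w * k⁻¹) ≤ d 1 k⁻¹ := fun w => by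
      have := hinv (k * w) 1 k⁻¹
      rw [mul_one] at this
      exact this.le
    simp only [map_mul, MulAut.mul_apply, hconj]
    refine H.isCenter_of_near hc (hnear _) (hnear _) (hnear _) ?_ ?_ ?_ <;> rw [hinv]
    · have := hfn _ (hx n)
      omega
    · have := hfn _ (hy n)
      omega
    · have := hfn _ (hz n)
      omega
  refine ⟨{g | Cen (2 * δ + 2 + 4 * δ) g⁻¹ 1}, fun g => ?_, fun t => ?_⟩
  · obtain ⟨m, hm⟩ := hexists g⁻¹
    refine ⟨m, ?_⟩
    have := htrans m⁻¹ _ _ _ hm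
    rw [inv_mul_cancel, map_inv, ← mul_inv_rev] at this
    exact this
  · obtain ⟨κ, hκ⟩ := hmapCen t⁻¹ (2 * δ + 2 + 4 * δ)
    refine (hball (max (κ + 4 * δ) (2 * δ + 2 + 4 * δ) + 2 * δ)).subset ?_
    rintro k ⟨a, ha, ha'⟩
    -- Both `k⁻¹` and `1` are centers for `(a * t * i k)⁻¹`, with constants depending only on `t`;
    -- hence they are close.
    have h1 := htrans k⁻¹ _ _ _ (hκ _ _ ha)
    rw [map_one, mul_one, map_inv, ← mul_inv_rev, ← mul_inv_rev] at h1
    have h2 := hunique _ _ _ _ (h1.mono fun n hn => hn.mono (le_max_left _ (2 * δ + 2 + 4 * δ)))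
      (Filter.Eventually.mono ha' fun n hn => hn.mono (le_max_right _ _))
    have h3 := hinv k k⁻¹ 1
    rw [mul_inv_cancel, mul_one] at h3
    rw [Set.mem_ofPred_eq, h3]
    exact h2

end RelHyp

/-! ### The theorem. -/

theorem theorem2p8 {K : Type*} {G : Type*} {Q : Type*} [Group K] [Group G] [Group Q]
    (hK : Group.FG K) (hG : Group.FG G) (hQ : Group.FG Q)
    (i : K →* G) (p : G →* Q) (hi : Function.Injective i) (hp : Function.Surjective p)
    (hip : i.range = p.ker)
    (K₁ : Subgroup K) (hproper : K₁ ≠ ⊤) (hnonelem : ¬ RelHyp.IsElementary K)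
    (hrel : RelHyp.IsStronglyHyperbolic K K₁)
    (hcusps : RelHyp.PreservesCusps i K₁) :
    ∃ s : Q → G, ∀ S : Finset G, Subgroup.closure (S : Set G) = ⊤ →
      ∀ T : Finset Q, Subgroup.closure (T : Set Q) = ⊤ →
        ∃ R ε : ℝ, 1 ≤ R ∧ 0 ≤ ε ∧
          RelHyp.IsQuasiIsometricSection p (S : Set G) (T : Set Q) R ε s := by
  have hn : i.range.Normal := hip ▸ inferInstance
  obtain ⟨A, hA, hfin⟩ : ∃ A : Set G, (∀ g, ∃ k, g * i k ∈ A) ∧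
      ∀ t : G, {k : K | ∃ a ∈ A, a * t * i k ∈ A}.Finite := by
    by_cases hinf : (K₁ : Set K).Infinite
    · exact RelHyp.exists_transversal_of_infinite i hi hn K₁ hproper hrel hcusps hinf
    · obtain ⟨-, S, hS, hweak, -⟩ := hrel
      obtain ⟨δ, hyp⟩ := hweak.exists_isHypMetric hS
      rw [RelHyp.cosetGraph_empty] at hyp
      exact RelHyp.exists_transversal_of_isHypMetric i hi hn hnonelem
        (S.finite_toSet.union (Set.not_infinite.1 hinf)) (RelHyp.closure_union_eq_top hS) hyp
  refine RelHyp.exists_section_of_transversal i p hp hip A (fun q => ?_) hfin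
  obtain ⟨g, rfl⟩ := hp q
  obtain ⟨k, hk⟩ := hA g
  have hik : p (i k) = 1 := by
    rw [← MonoidHom.mem_ker, ← hip]
    exact ⟨k, rfl⟩
  exact ⟨_, hk, by rw [map_mul, hik, mul_one]⟩
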